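/- Let $U\subset\mathbb{R}^2$ be a domain (a nonempty connected open set), let $\lambda\in\mathbb{R}$, $\lambda\neq 0$, and let $w:U\to\mathbb{R}$ be a $C^2$ function, not identically zero, with $\Delta w=\lambda w$ on $U$. For $q=(x_q,y_q)\in\mathbb{R}^2$ let $$R_q w(x,y)=(x-x_q)\,\partial_y w(x,y)-(y-y_q)\,\partial_x w(x,y)$$ be the rotational derivative of $w$ about $q$ (that is, $R_q=\partial_\theta$ in polar coordinates centred at $q$), and let $\mathcal{Z}(R_q w)=\{z\in U: R_qw(z)=0\}$ be its nodal set. Call $p$ a vertex of degree $d$ of a set $Z\subset\mathbb{R}^2$ if, in some neighbourhood of $p$, the set $Z$ consists of $p$ and exactly $d$ simple arcs that start at $p$ and are pairwise disjoint apart from $p$. Let $C=\gamma(I)\subset U$ be a real-analytic arc, where $I\subset\mathbb{R}$ is an interval with more than one point and $\gamma$ is real-analytic on (a neighbourhood of) $I$ with $\gamma'\neq 0$ on $I$. Assume that $C$ is neither a subset of a circle nor a subset of a straight line, and that every point of $C$ is a critical point of $w$. Let $p=\gamma(t)$, $t\in I$, be a point of $C$ and let $q\in\mathbb{R}^2$.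 Let $N_C(p)$ denote the normal line to $C$ at $p$ and, if the curvature of $C$ at $p$ is nonzero, let $\xi_C(p)\in N_C(p)$ denote the centre of curvature of $C$ at $p$ (if the curvature vanishes at $p$, no point of the plane is the centre of curvature there). Then: 1. if $q\notin N_C(p)$, then $p$ is a vertex of $\mathcal{Z}(R_q w)$ of degree $2$; 2. if $q\in N_C(p)$ and $q$ is not the centre of curvature $\xi_C(p)$, then $p$ is a vertex of $\mathcal{Z}(R_q w)$ of degree $4$; 3. if $q=\xi_C(p)$, then $p$ is a vertex of $\mathcal{Z}(R_q w)$ of degree at least $6$. -/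

import Mathlib

open Set Topology
open scoped Laplacian

/-- The Euclidean plane. -/
abbrev Plane : Type := EuclideanSpace ℝ (Fin 2)

/-- Rotation of a vector by `π / 2` (counterclockwise): `(a, b) ↦ (-b, a)`. -/
noncomputable def quarterTurn (v : Plane) : Plane := !₂[-v 1, v 0]

/-- The derivative `R_q w` of `w` along the rotational vector field `R_q = ∂_θ`, `(r, θ)` being
polar coordinates centred at `q`:
`R_q w (x, y) = (x - x_q) * w_y (x, y) - (y - y_q) * w_x (x, y)`. -/
noncomputable def rotDeriv (q : Plane) (w : Plane → ℝ) (z : Plane) : ℝ :=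
  fderiv ℝ w z (quarterTurn (z - q))

/-- The nodal set in `U` of a function on `U`. -/
def nodalSet (U : Set Plane) (f : Plane → ℝ) : Set Plane := {z ∈ U | f z = 0}

/-- The set of critical points in `U` of a differentiable function on `U`. -/
def critSet (U : Set Plane) (w : Plane → ℝ) : Set Plane := {z ∈ U | fderiv ℝ w z = 0}

/-- `γ`, restricted to `I`, is a regular real-analytic parametrization of an arc: `I` is an interval
with more than one point (open, closed or half-open, bounded or not), `γ` is real-analytic at all
points of `I`, its endpoints included if they belong to `I`, and its velocity does not vanish.
Injectivity is not demanded, so that closed curves are covered too. -/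
structure IsAnalyticArc (γ : ℝ → Plane) (I : Set ℝ) : Prop where
  ordConnected : I.OrdConnected
  nontrivial : I.Nontrivial
  analytic : AnalyticOnNhd ℝ γ I
  regular : ∀ t ∈ I, deriv γ t ≠ 0

/-- The normal line to the curve `γ` at the point `γ t`. -/
def normalLine (γ : ℝ → Plane) (t : ℝ) : Set Plane :=
  {q | inner ℝ (deriv γ t) (q - γ t) = 0}

/-- The unit normal of `γ` at `γ t`, a quarter turn ahead of the unit tangent. -/
noncomputable def unitNormal (γ : ℝ → Plane) (t : ℝ) : Plane :=
  ‖deriv γ t‖⁻¹ • quarterTurn (deriv γ t)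

/-- The signed curvature `(x' y'' - y' x'') / |γ'| ^ 3` of `γ = (x, y)` at `γ t`, with respect to
`unitNormal γ t`. -/
noncomputable def signedCurvature (γ : ℝ → Plane) (t : ℝ) : ℝ :=
  (deriv γ t 0 * deriv (deriv γ) t 1 - deriv γ t 1 * deriv (deriv γ) t 0) / ‖deriv γ t‖ ^ 3

/-- `q` is the centre of curvature of `γ` at `γ t`. No point is the centre of curvature where the
curvature vanishes (the centre of curvature is at infinity there). -/
def IsCentreOfCurvature (γ : ℝ → Plane) (t : ℝ) (q : Plane) : Prop :=
  signedCurvature γ t ≠ 0 ∧ q = γ t + (signedCurvature γ t)⁻¹ • unitNormal γ t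

/-- `p` is a vertex of degree `d` of `Z`: in some neighbourhood of `p`, the set `Z` consists of `p`
and exactly `d` simple arcs that start at `p` and are pairwise disjoint apart from `p`. -/
def IsVertexOfDegree (Z : Set Plane) (p : Plane) (d : ℕ) : Prop :=
  ∃ V ∈ 𝓝 p, ∃ e : Fin d → ℝ → Plane,
    (∀ i, ContinuousOn (e i) (Icc 0 1)) ∧
    (∀ i, InjOn (e i) (Icc 0 1)) ∧
    (∀ i, e i 0 = p) ∧
    (∀ i j, i ≠ j → e i '' Icc 0 1 ∩ e j '' Icc 0 1 = {p}) ∧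
    Z ∩ V = {p} ∪ ⋃ i, e i '' Icc 0 1

/-! Put μ = λ/4 and f = R_q w. The proof compares two ways of measuring how fast the gradient of f
vanishes at p = γ t.

Off the arc: about any point of U, a solution of Δw = 4μw is the real part of a series of
cylindrical solutions z^n E_n(|z|²) (`hasCylExpansion_of_laplace`). Rotations and translations
preserve the equation, so R_q maps such series to such series (`HasCylExpansion.rotation`). Hence f
vanishes near p, or f(p) ≠ 0, or f has a leading term Re(A z^(m+1)) with A ≠ 0
(`HasCylExpansion.trichotomy`). In the last case the zero set near p is made of 2(m+1) arcs
(`HasHarmonicLeadingTerm.exists_arcs`), and |∇f| is comparable to |z|^m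
(`HasHarmonicLeadingTerm.norm_fderiv_bounds`). The degree of the vertex can therefore be read off
from |∇f| along any curve that ends at p.

Along the arc: ∇w = 0 on C, so the Hessian of w kills the tangent and, having trace 4μw, equals 4μw
n ⊗ n with n the unit normal. Therefore |∇f(γ s)| = |4μ w(γ s)| |δ(s)| / |γ'(s)| with δ(s) = ⟨γ'(s),
γ(s) − q⟩ (`IsAnalyticArc.norm_fderiv_rotDeriv`). The factor w(γ s) is nonzero
(`IsAnalyticArc.apply_ne_zero`), so m is the order of vanishing of δ at t.

Now δ is half the derivative of |γ − q|². It is nonzero at t exactly when q is off the normal line,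
and δ = δ' = 0 at t exactly when q is the centre of curvature (`isCentreOfCurvature_iff`). This
separates m = 0, m = 1 and m ≥ 2, that is, degrees 2, 4 and at least 6. If f vanished near p, then δ
would vanish identically by analyticity and C would lie on a circle (`IsAnalyticArc.subset_sphere`).
-/

/-! ### Modified Bessel functions -/

/-- The entire function `s ↦ ∑ (μ s)^k / (k! (n + k)!)`, a modified Bessel function up to the
substitution `s = r ^ 2` and a power of `r`. -/
noncomputable def besselE (μ : ℝ) (n : ℕ) (s : ℝ) : ℝ :=
  ∑' k : ℕ, (μ * s) ^ k / (k.factorial * (n + k).factorial)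

lemma real_exp_eq_tsum (x : ℝ) : Real.exp x = ∑' k : ℕ, x ^ k / k.factorial := by
  rw [Real.exp_eq_exp_ℝ]
  exact congrFun NormedSpace.exp_eq_tsum_div x

/-- Since (n + k)! ≥ n!, the series is dominated by an exponential with the factor 1/n! kept. This
factor later offsets coefficients that grow like n!. -/
lemma besselE_term_norm_le (x : ℝ) (n k : ℕ) :
    ‖x ^ k / ((k.factorial : ℝ) * (n + k).factorial)‖ ≤
      (n.factorial : ℝ)⁻¹ * (|x| ^ k / k.factorial) := by
  rw [norm_div, norm_pow, Real.norm_eq_abs, Real.norm_of_nonneg (by positivity), inv_mul_eq_div,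
    div_div]
  gcongr
  omega

lemma summable_besselE_bound (x : ℝ) (n : ℕ) :
    Summable fun k : ℕ => (n.factorial : ℝ)⁻¹ * (|x| ^ k / k.factorial) :=
  (Real.summable_pow_div_factorial |x|).mul_left _

lemma summable_besselE (μ s : ℝ) (n : ℕ) :
    Summable fun k : ℕ => (μ * s) ^ k / ((k.factorial : ℝ) * (n + k).factorial) :=
  .of_norm_bounded (summable_besselE_bound (μ * s) n) fun k => besselE_term_norm_le _ n k

lemma abs_besselE_le (μ s : ℝ) (n : ℕ) : |besselE μ n s| ≤ Real.exp |μ * s| / n.factorial := by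
  have h := tsum_of_norm_bounded (summable_besselE_bound (μ * s) n).hasSum
    fun k => besselE_term_norm_le (μ * s) n k
  rw [tsum_mul_left, ← real_exp_eq_tsum] at h
  rwa [div_eq_inv_mul]

lemma besselE_zero_right (μ : ℝ) (n : ℕ) : besselE μ n 0 = (n.factorial : ℝ)⁻¹ := by
  rw [besselE, tsum_eq_single 0]
  · simp
  · intro k hk; simp [hk]

/-- The term k = 0 is 1/n! and the others add up to at most (exp |μ s| − 1)/n!. The range of s in
which this gives positivity does not depend on n. -/
lemma besselE_ge (μ s : ℝ) (n : ℕ) :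
    (2 - Real.exp |μ * s|) / n.factorial ≤ besselE μ n s := by
  have hE := real_exp_eq_tsum |μ * s|
  have hs := Real.summable_pow_div_factorial |μ * s|
  rw [hs.tsum_eq_zero_add] at hE
  rw [besselE, (summable_besselE μ s n).tsum_eq_zero_add]
  have h := tsum_of_norm_bounded
    ((summable_nat_add_iff 1).2 (summable_besselE_bound (μ * s) n)).hasSum
    fun k => besselE_term_norm_le (μ * s) n (k + 1)
  rw [tsum_mul_left] at h
  simp only [pow_zero, Nat.factorial_zero, Nat.cast_one, add_zero, one_mul, div_one] at hE ⊢
  have h' := (abs_le.1 h).1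
  have : (2 - Real.exp |μ * s|) / n.factorial
      = 1 / n.factorial - (n.factorial : ℝ)⁻¹ * (Real.exp |μ * s| - 1) := by ring
  rw [this, hE]
  simp only [add_sub_cancel_left]
  linarith

lemma besselE_deriv_term (μ y : ℝ) (n k : ℕ) :
    ((k + 1 : ℕ) * (μ * y) ^ (k + 1 - 1) * μ) / (((k + 1).factorial : ℝ) * (n + (k + 1)).factorial)
      = μ * ((μ * y) ^ k / ((k.factorial : ℝ) * (n + 1 + k).factorial)) := by
  rw [Nat.factorial_succ k, Nat.add_sub_cancel, show n + 1 + k = n + (k + 1) by ring]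
  push_cast
  field_simp

lemma hasDerivAt_besselE (μ : ℝ) (n : ℕ) (s : ℝ) :
    HasDerivAt (besselE μ n) (μ * besselE μ (n + 1) s) s := by
  -- Majorant on the ball of radius |s| + 1. At k = 0 the truncated k - 1 gives |μ|, which is
  -- harmless since the differentiated term is 0.
  have hu : Summable fun k : ℕ => |μ| * ((|μ| * (|s| + 1)) ^ (k - 1) / (k - 1).factorial) :=
    (Summable.mul_left _ <| (summable_nat_add_iff 1).1 <| by
      simpa using Real.summable_pow_div_factorial (|μ| * (|s| + 1)))
  have hs : s ∈ Metric.ball (0 : ℝ) (|s| + 1) := by simp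
  have key : HasDerivAt (fun x => ∑' k : ℕ, (μ * x) ^ k / ((k.factorial : ℝ) * (n + k).factorial))
      (∑' k : ℕ, (k * (μ * s) ^ (k - 1) * μ) / ((k.factorial : ℝ) * (n + k).factorial)) s := by
    refine hasDerivAt_tsum_of_isPreconnected
      (g := fun (k : ℕ) (x : ℝ) => (μ * x) ^ k / ((k.factorial : ℝ) * (n + k).factorial))
      (g' := fun (k : ℕ) (x : ℝ) =>
        (k * (μ * x) ^ (k - 1) * μ) / ((k.factorial : ℝ) * (n + k).factorial))
      hu Metric.isOpen_ball
      (convex_ball _ _).isPreconnected (fun k y _ => ?_) (fun k y hy => ?_) hs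
      (summable_besselE μ s n) hs
    · have := (((hasDerivAt_id y).const_mul μ).pow k).div_const
        ((k.factorial : ℝ) * (n + k).factorial)
      simpa using this
    · rcases k with _ | k
      · simp
      · have hy' : |y| ≤ |s| + 1 := by simpa using (Metric.mem_ball.1 hy).le
        rw [besselE_deriv_term, norm_mul, norm_div, norm_pow, norm_mul, Real.norm_eq_abs,
          Real.norm_eq_abs, Real.norm_of_nonneg (by positivity), Nat.add_sub_cancel]
        gcongr
        have : (1 : ℝ) ≤ (n + 1 + k).factorial := by exact_mod_cast Nat.factorial_pos _
        nlinarith [Nat.cast_pos (α := ℝ).2 (Nat.factorial_pos k)]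
  have hsum : Summable fun k : ℕ => ((k + 1 : ℕ) * (μ * s) ^ (k + 1 - 1) * μ) /
      (((k + 1).factorial : ℝ) * (n + (k + 1)).factorial) :=
    ((summable_besselE μ s (n + 1)).mul_left μ).congr fun k => (besselE_deriv_term μ s n k).symm
  have hval : (∑' k : ℕ, (k * (μ * s) ^ (k - 1) * μ) / ((k.factorial : ℝ) * (n + k).factorial))
      = μ * besselE μ (n + 1) s := by
    have h0 := ((summable_nat_add_iff (f := fun k : ℕ =>
      (k * (μ * s) ^ (k - 1) * μ) / ((k.factorial : ℝ) * (n + k).factorial)) 1).1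
        hsum).tsum_eq_zero_add
    rw [h0, tsum_congr (besselE_deriv_term μ s n), tsum_mul_left, besselE]
    simp
  rw [← hval]
  exact key

/-- Write 1/(n+k)! as ((n+1) + k)/(n+1+k)!. The summand n+1 gives the first series, and k cancels
into k! and shifts the index. -/
lemma besselE_eq (μ : ℝ) (n : ℕ) (s : ℝ) :
    besselE μ n s = (n + 1) * besselE μ (n + 1) s + μ * s * besselE μ (n + 2) s := by
  have hterm (k : ℕ) : μ * s * ((μ * s) ^ k / ((k.factorial : ℝ) * (n + 2 + k).factorial))
      = (k + 1 : ℕ) * ((μ * s) ^ (k + 1) /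
        (((k + 1).factorial : ℝ) * (n + 1 + (k + 1)).factorial)) := by
    rw [Nat.factorial_succ k, show n + 2 + k = n + 1 + (k + 1) by ring]
    push_cast
    field_simp
    ring
  have hsum : Summable fun k : ℕ =>
      k * ((μ * s) ^ k / ((k.factorial : ℝ) * (n + 1 + k).factorial)) :=
    (summable_nat_add_iff 1).1 <| ((summable_besselE μ s (n + 2)).mul_left (μ * s)).congr hterm
  have h2 : μ * s * besselE μ (n + 2) s
      = ∑' k : ℕ, k * ((μ * s) ^ k / ((k.factorial : ℝ) * (n + 1 + k).factorial)) := by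
    rw [besselE, ← tsum_mul_left, hsum.tsum_eq_zero_add]
    simp only [Nat.cast_zero, zero_mul, zero_add]
    exact tsum_congr hterm
  rw [h2, besselE, besselE, ← tsum_mul_left,
    ← (Summable.mul_left _ (summable_besselE μ s _)).tsum_add hsum]
  refine tsum_congr fun k => ?_
  rw [show n + 1 + k = (n + k) + 1 by ring, Nat.factorial_succ (n + k)]
  push_cast
  field_simp
  ring

/-! ### Cylindrical solutions and their derivatives -/

/-- The cylindrical solution `z ^ n * E_n (|z| ^ 2)` of `Δ u = 4 μ u` in the plane. -/
noncomputable def cyl (μ : ℝ) (n : ℕ) (z : ℂ) : ℂ := z ^ n * (besselE μ n (Complex.normSq z) : ℝ)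

lemma norm_cyl_le (μ : ℝ) (n : ℕ) {z : ℂ} (hz : ‖z‖ ≤ 1) :
    ‖cyl μ n z‖ ≤ Real.exp |μ| * (‖z‖ ^ n / n.factorial) := by
  rw [cyl, norm_mul, norm_pow, Complex.norm_real, Real.norm_eq_abs]
  rw [mul_div_left_comm]
  refine mul_le_mul_of_nonneg_left ((abs_besselE_le _ _ _).trans ?_) (by positivity)
  refine div_le_div_of_nonneg_right (Real.exp_le_exp.2 ?_) (by positivity)
  rw [abs_mul, Complex.normSq_eq_norm_sq, abs_of_nonneg (sq_nonneg ‖z‖)]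
  exact mul_le_of_le_one_right (abs_nonneg _) (pow_le_one₀ (norm_nonneg _) hz)

lemma hasFDerivAt_normSq (z : ℂ) :
    HasFDerivAt (fun z : ℂ => Complex.normSq z) ((2 : ℝ) • innerSL ℝ z) z := by
  simp_rw [Complex.normSq_eq_norm_sq]
  have := (hasStrictFDerivAt_norm_sq z).hasFDerivAt
  refine this.congr_fderiv ?_
  ext v
  simp
  ring

lemma inner_eq_re (z v : ℂ) : inner ℝ z v = (starRingEnd ℂ z * v).re := by
  simp [Complex.inner]; ring

/-- The derivative of `cyl μ n`, before the recursion for `besselE` is used. -/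
noncomputable def cylDeriv (μ : ℝ) (n : ℕ) (z : ℂ) : ℂ →L[ℝ] ℂ :=
  ((n * z ^ (n - 1) * (besselE μ n (Complex.normSq z) : ℝ) : ℂ)) • ContinuousLinearMap.id ℝ ℂ +
    (z ^ n * (μ * besselE μ (n + 1) (Complex.normSq z) * 2 : ℝ) : ℂ) •
      (Complex.ofRealCLM.comp (innerSL ℝ z))

lemma hasFDerivAt_cyl (μ : ℝ) (n : ℕ) (z : ℂ) : HasFDerivAt (cyl μ n) (cylDeriv μ n z) z := by
  have h1 : HasFDerivAt (fun z : ℂ => z ^ n)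
      ((n * z ^ (n - 1) : ℂ) • ContinuousLinearMap.id ℝ ℂ) z := by
    have := (hasDerivAt_pow n z).hasFDerivAt.restrictScalars ℝ
    refine this.congr_fderiv ?_
    ext v
    all_goals simp [mul_comm]
  have h2 := Complex.ofRealCLM.hasFDerivAt.comp z
    ((hasDerivAt_besselE μ n (Complex.normSq z)).comp_hasFDerivAt z (hasFDerivAt_normSq z))
  have h3 := h1.mul h2
  refine h3.congr_fderiv ?_
  ext v
  all_goals simp [cylDeriv]
  all_goals ring

lemma cylDeriv_apply (μ : ℝ) (n : ℕ) (z v : ℂ) : cylDeriv μ n z v =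
    n * z ^ (n - 1) * (besselE μ n (Complex.normSq z) : ℝ) * v +
    z ^ n * (μ * besselE μ (n + 1) (Complex.normSq z)) *
      (starRingEnd ℂ z * v + z * starRingEnd ℂ v) := by
  have : (2 * (inner ℝ z v : ℝ) : ℂ) = starRingEnd ℂ z * v + z * starRingEnd ℂ v := by
    rw [inner_eq_re]
    have := Complex.add_conj (starRingEnd ℂ z * v)
    rw [map_mul, Complex.conj_conj] at this
    rw [this]; push_cast; ring
  rw [← this, cylDeriv]
  simp
  ring

/-- The ladder relations: ∂/∂z lowers the index by one, and ∂/∂z̄ raises it by one with a factor μ.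
The Bessel recursion is what makes the ∂/∂z part collapse to one term. -/
lemma cylDeriv_succ (μ : ℝ) (n : ℕ) (z v : ℂ) : cylDeriv μ (n + 1) z v =
    v * cyl μ n z + μ * starRingEnd ℂ v * cyl μ (n + 2) z := by
  rw [cylDeriv_apply, cyl, cyl, besselE_eq μ n]
  have : z * starRingEnd ℂ z = (Complex.normSq z : ℂ) := Complex.mul_conj z
  push_cast
  rw [← this]
  rw [show n + 1 + 1 = n + 2 from rfl]
  ring

/-- The bottom of the ladder: the solution of index 0 is real, so its z and z̄ parts are conjugate
and both have index 1. -/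
lemma cylDeriv_zero (μ : ℝ) (z v : ℂ) : cylDeriv μ 0 z v =
    μ * (starRingEnd ℂ v * cyl μ 1 z + starRingEnd ℂ (starRingEnd ℂ v * cyl μ 1 z)) := by
  rw [cylDeriv_apply, cyl]
  simp
  ring

lemma cylDeriv_rotation (μ : ℝ) (n : ℕ) (z : ℂ) :
    cylDeriv μ n z (Complex.I * z) = Complex.I * n * cyl μ n z := by
  rw [cylDeriv_apply, cyl]
  rcases n with _ | n
  · simp; ring_nf; simp
  · simp
    ring

/-! ### Series of cylindrical solutions -/

section

open Asymptotics Filter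

/-- Growth condition on coefficients that makes `∑ b n * cyl μ n z` converge near `0`. -/
def CylAdmissible (b : ℕ → ℂ) : Prop :=
  ∃ K : ℝ, 1 ≤ K ∧ ∀ n, ‖b n‖ ≤ K ^ (n + 1) * n.factorial

/-- The real part of a series of cylindrical solutions. -/
noncomputable def cylSum (μ : ℝ) (b : ℕ → ℂ) (z : ℂ) : ℝ := ∑' n, (b n * cyl μ n z).re

/-- Coefficients of the derivative of `cylSum μ b` in the direction `v`. -/
noncomputable def cylShift (μ : ℝ) (v : ℂ) (b : ℕ → ℂ) : ℕ → ℂ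
  | 0 => v * b 1
  | 1 => v * b 2 + μ * starRingEnd ℂ v * (2 * (b 0).re)
  | n + 2 => v * b (n + 3) + μ * starRingEnd ℂ v * b (n + 1)

lemma CylAdmissible.add {b c : ℕ → ℂ} (hb : CylAdmissible b) (hc : CylAdmissible c) :
    CylAdmissible (b + c) := by
  obtain ⟨K, hK, hb⟩ := hb
  obtain ⟨L, hL, hc⟩ := hc
  refine ⟨K + L, by linarith, fun n => (norm_add_le _ _).trans ?_⟩
  refine (add_le_add (hb n) (hc n)).trans ?_
  rw [← add_mul]
  gcongr
  exact pow_add_pow_le (by positivity) (by positivity) (by omega)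

lemma CylAdmissible.of_norm_le {b c : ℕ → ℂ} (hb : CylAdmissible b) {C : ℝ}
    (h : ∀ n, ‖c n‖ ≤ C * ‖b n‖) : CylAdmissible c := by
  obtain ⟨K, hK, hb⟩ := hb
  refine ⟨(1 + |C|) * K, by nlinarith [abs_nonneg C], fun n => (h n).trans ?_⟩
  calc C * ‖b n‖ ≤ (1 + |C|) * (K ^ (n + 1) * n.factorial) := by
        gcongr
        · linarith [le_abs_self C]
        · exact hb n
    _ ≤ ((1 + |C|) * K) ^ (n + 1) * n.factorial := by
        rw [mul_pow, ← mul_assoc]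
        gcongr
        exact le_self_pow₀ (by linarith [abs_nonneg C]) (by omega)

lemma CylAdmissible.succ {b : ℕ → ℂ} (hb : CylAdmissible b) :
    CylAdmissible fun n => b (n + 1) := by
  obtain ⟨K, hK, hb⟩ := hb
  -- The shift costs a factor n + 1, absorbed by 2^(n+1), and one more K, absorbed by the second
  -- K^(n+1).
  refine ⟨2 * K * K, by nlinarith, fun n => (hb _).trans ?_⟩
  have h : ((n + 1 : ℕ) : ℝ) ≤ 2 ^ (n + 1) := by exact_mod_cast Nat.lt_two_pow_self.le
  rw [Nat.factorial_succ, Nat.cast_mul, ← mul_assoc]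
  gcongr
  rw [mul_pow, mul_pow, mul_comm, pow_succ K (n + 1)]
  have : K ≤ K ^ (n + 1) := le_self_pow₀ hK (by omega)
  rw [← mul_assoc]
  gcongr

lemma CylAdmissible.rotation {b : ℕ → ℂ} (hb : CylAdmissible b) :
    CylAdmissible fun n => Complex.I * n * b n := by
  obtain ⟨K, hK, hb⟩ := hb
  refine ⟨2 * K, by nlinarith, fun n => ?_⟩
  have h : (n : ℝ) ≤ 2 ^ (n + 1) := by
    exact_mod_cast (Nat.le_succ n).trans Nat.lt_two_pow_self.le
  rw [norm_mul, norm_mul, Complex.norm_I, one_mul, Complex.norm_natCast, mul_pow, mul_assoc]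
  gcongr
  exact hb n

lemma CylAdmissible.prev {b : ℕ → ℂ} (hb : CylAdmissible b) :
    CylAdmissible fun n => b (n - 1) := by
  obtain ⟨K, hK, hb⟩ := hb
  refine ⟨K, hK, fun n => (hb _).trans ?_⟩
  gcongr
  · omega
  · omega

lemma CylAdmissible.shift {b : ℕ → ℂ} (hb : CylAdmissible b) (μ : ℝ) (v : ℂ) :
    CylAdmissible (cylShift μ v b) := by
  have h1 : CylAdmissible fun n => v * b (n + 1) :=
    hb.succ.of_norm_le (C := ‖v‖) fun n => by rw [norm_mul]
  -- What is left is the raising part, controlled by b (n - 1). At n = 0 it vanishes, so the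
  -- truncated subtraction does no harm; the factor 2 comes from index 1.
  have h2 : CylAdmissible fun n => cylShift μ v b n - v * b (n + 1) := by
    refine hb.prev.of_norm_le (C := 2 * |μ| * ‖v‖) fun n => ?_
    rcases n with _ | _ | n
    · simp only [cylShift, zero_add, sub_self, norm_zero]; positivity
    · simp only [cylShift, zero_add, add_sub_cancel_left, norm_mul, Complex.norm_real,
        RCLike.norm_conj, Real.norm_eq_abs, Complex.norm_ofNat, Nat.sub_self]
      nlinarith [mul_le_mul_of_nonneg_left (Complex.abs_re_le_norm (b 0))
        (by positivity : 0 ≤ |μ| * ‖v‖)]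
    · simp only [cylShift, add_sub_cancel_left, norm_mul, Complex.norm_real,
        RCLike.norm_conj, Real.norm_eq_abs, Nat.add_sub_cancel]
      nlinarith [norm_nonneg (b (n + 1)), mul_nonneg (mul_nonneg (abs_nonneg μ) (norm_nonneg v))
        (norm_nonneg (b (n + 1)))]
  convert h1.add h2 using 1
  ext n
  simp

section Bounds

variable {μ K : ℝ} {b : ℕ → ℂ}

lemma norm_term_cyl_le (hK : 1 ≤ K) (hb : ∀ n, ‖b n‖ ≤ K ^ (n + 1) * n.factorial)
    {z : ℂ} (hz : ‖z‖ ≤ 1) (n : ℕ) :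
    ‖b n * cyl μ n z‖ ≤ K * Real.exp |μ| * (K * ‖z‖) ^ n := by
  rw [norm_mul]
  calc ‖b n‖ * ‖cyl μ n z‖
      ≤ (K ^ (n + 1) * n.factorial) * (Real.exp |μ| * (‖z‖ ^ n / n.factorial)) :=
        mul_le_mul (hb n) (norm_cyl_le μ n hz) (norm_nonneg _) (by positivity)
    _ = _ := by rw [mul_pow]; field_simp; ring

lemma summable_term_cyl (hK : 1 ≤ K) (hb : ∀ n, ‖b n‖ ≤ K ^ (n + 1) * n.factorial)
    {z : ℂ} (hz : K * ‖z‖ < 1) : Summable fun n => b n * cyl μ n z := by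
  have hz1 : ‖z‖ ≤ 1 := by nlinarith [norm_nonneg z]
  exact .of_norm_bounded
    ((summable_geometric_of_lt_one (by positivity) hz).mul_left _) (norm_term_cyl_le hK hb hz1)

/-- Lowering the index leaves 1/n! against (n+1)!, hence a surplus factor n + 1 ≤ 2^n. The radius
1/4 in place of 1 pays for it and leaves the ratio 1/2. -/
lemma norm_cylDeriv_le (hK : 1 ≤ K) (hb : ∀ n, ‖b n‖ ≤ K ^ (n + 1) * n.factorial)
    {z : ℂ} (hz : K * ‖z‖ ≤ 1 / 4) (n : ℕ) :
    ‖b n‖ * ‖cylDeriv μ n z‖ ≤ 4 * Real.exp |μ| * (1 + |μ|) * K ^ 2 * (1 / 2) ^ n := by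
  have hz1 : ‖z‖ ≤ 1 := by nlinarith [norm_nonneg z]
  rcases n with _ | n
  · have h : ‖cylDeriv μ 0 z‖ ≤ 2 * |μ| * Real.exp |μ| := by
      refine ContinuousLinearMap.opNorm_le_bound _ (by positivity) fun v => ?_
      have h1 : ‖cyl μ 1 z‖ ≤ Real.exp |μ| := (norm_cyl_le μ 1 hz1).trans
        (mul_le_of_le_one_right (Real.exp_pos _).le (by simpa using hz1))
      rw [cylDeriv_zero, norm_mul, Complex.norm_real, Real.norm_eq_abs]
      have h2 := norm_add_le (starRingEnd ℂ v * cyl μ 1 z)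
        (starRingEnd ℂ (starRingEnd ℂ v * cyl μ 1 z))
      simp only [RCLike.norm_conj, norm_mul] at h2
      calc _ ≤ |μ| * (‖v‖ * ‖cyl μ 1 z‖ + ‖v‖ * ‖cyl μ 1 z‖) := by gcongr
        _ ≤ |μ| * (‖v‖ * Real.exp |μ| + ‖v‖ * Real.exp |μ|) := by gcongr
        _ = _ := by ring
    have hb0 : ‖b 0‖ ≤ K ^ 2 := (by simpa using hb 0 : ‖b 0‖ ≤ K).trans (by nlinarith)
    calc _ ≤ K ^ 2 * (2 * |μ| * Real.exp |μ|) := by gcongr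
      _ ≤ _ := by
        have : 0 ≤ Real.exp |μ| * K ^ 2 := by positivity
        nlinarith [mul_nonneg this (abs_nonneg μ)]
  · have h : ‖cylDeriv μ (n + 1) z‖ ≤ Real.exp |μ| * (1 + |μ|) * (‖z‖ ^ n / n.factorial) := by
      refine ContinuousLinearMap.opNorm_le_bound _ (by positivity) fun v => ?_
      have h1 := norm_cyl_le μ n hz1
      have h2 : ‖cyl μ (n + 2) z‖ ≤ Real.exp |μ| * (‖z‖ ^ n / n.factorial) := by
        refine (norm_cyl_le μ (n + 2) hz1).trans ?_
        gcongr ?_ * (?_ / ?_)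
        · exact pow_le_pow_of_le_one (norm_nonneg _) hz1 (by omega)
        · exact_mod_cast Nat.factorial_le (by omega)
      rw [cylDeriv_succ]
      refine (norm_add_le _ _).trans ?_
      simp only [norm_mul, RCLike.norm_conj, Complex.norm_real, Real.norm_eq_abs]
      calc _ ≤ ‖v‖ * (Real.exp |μ| * (‖z‖ ^ n / n.factorial)) +
            |μ| * ‖v‖ * (Real.exp |μ| * (‖z‖ ^ n / n.factorial)) := by gcongr
        _ = _ := by ring
    have h3 : ((n + 1 : ℕ) : ℝ) * (K * ‖z‖) ^ n ≤ 2 * (1 / 2) ^ (n + 1) := by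
      have h4 : ((n + 1 : ℕ) : ℝ) ≤ 2 ^ n := by exact_mod_cast Nat.lt_two_pow_self
      calc _ ≤ 2 ^ n * (1 / 4 : ℝ) ^ n := by gcongr
        _ = _ := by rw [← mul_pow, pow_succ]; norm_num; ring
    calc _ ≤ (K ^ (n + 1 + 1) * (n + 1).factorial) *
          (Real.exp |μ| * (1 + |μ|) * (‖z‖ ^ n / n.factorial)) := by gcongr; exact hb _
      _ = Real.exp |μ| * (1 + |μ|) * K ^ 2 * (((n + 1 : ℕ) : ℝ) * (K * ‖z‖) ^ n) := by
          rw [Nat.factorial_succ]; push_cast; rw [mul_pow]; field_simp; ring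
      _ ≤ Real.exp |μ| * (1 + |μ|) * K ^ 2 * (2 * (1 / 2) ^ (n + 1)) := by gcongr
      _ ≤ _ := by
        have : 0 ≤ Real.exp |μ| * (1 + |μ|) * K ^ 2 * (1 / 2) ^ (n + 1) := by positivity
        linarith

lemma hasFDerivAt_cylSum (hK : 1 ≤ K) (hb : ∀ n, ‖b n‖ ≤ K ^ (n + 1) * n.factorial)
    {z : ℂ} (hz : K * ‖z‖ < 1 / 4) :
    HasFDerivAt (cylSum μ b) (∑' n, Complex.reCLM.comp (b n • cylDeriv μ n z)) z ∧
      Summable fun n => Complex.reCLM.comp (b n • cylDeriv μ n z) := by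
  have hu : Summable fun n : ℕ => 4 * Real.exp |μ| * (1 + |μ|) * K ^ 2 * (1 / 2) ^ n :=
    (summable_geometric_of_lt_one (by norm_num) (by norm_num)).mul_left _
  have hK0 : 0 < K := by linarith
  have hbd : ∀ (n : ℕ) (y : ℂ), y ∈ Metric.ball (0 : ℂ) (1 / (4 * K)) →
      ‖Complex.reCLM.comp (b n • cylDeriv μ n y)‖
        ≤ 4 * Real.exp |μ| * (1 + |μ|) * K ^ 2 * (1 / 2) ^ n := by
    intro n y hy
    have hy' : K * ‖y‖ ≤ 1 / 4 := by
      rw [mem_ball_zero_iff, lt_div_iff₀ (by positivity)] at hy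
      linarith
    refine le_trans ?_ (norm_cylDeriv_le (μ := μ) hK hb hy' n)
    refine (ContinuousLinearMap.opNorm_comp_le _ _).trans ?_
    rw [Complex.reCLM_norm, one_mul, norm_smul]
  have hzmem : z ∈ Metric.ball (0 : ℂ) (1 / (4 * K)) := by
    rw [mem_ball_zero_iff, lt_div_iff₀ (by positivity)]; linarith
  refine ⟨?_, .of_norm_bounded hu fun n => hbd n z hzmem⟩
  refine hasFDerivAt_tsum_of_isPreconnected (f := fun n z => (b n * cyl μ n z).re)
    (f' := fun n z => Complex.reCLM.comp (b n • cylDeriv μ n z)) hu Metric.isOpen_ball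
    (convex_ball _ _).isPreconnected (fun n y _ => ?_) hbd hzmem ?_ hzmem
  · exact Complex.reCLM.hasFDerivAt.comp y ((hasFDerivAt_cyl μ n y).const_mul (b n))
  · exact Complex.reCLM.summable (summable_term_cyl hK hb (by linarith))

lemma fderiv_cylSum_apply (hK : 1 ≤ K) (hb : ∀ n, ‖b n‖ ≤ K ^ (n + 1) * n.factorial)
    {z : ℂ} (hz : K * ‖z‖ < 1 / 4) (v : ℂ) :
    HasSum (fun n => (b n * cylDeriv μ n z v).re) (fderiv ℝ (cylSum μ b) z v) := by
  obtain ⟨h1, h2⟩ := hasFDerivAt_cylSum (μ := μ) hK hb hz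
  rw [h1.fderiv]
  exact (ContinuousLinearMap.apply ℝ ℝ v).hasSum h2.hasSum

end Bounds

lemma Summable.complex_re {f : ℕ → ℂ} (hf : Summable f) : Summable fun n => (f n).re :=
  Complex.reCLM.summable hf

lemma CylAdmissible.eventually_summable {b : ℕ → ℂ} (hb : CylAdmissible b) (μ : ℝ) :
    ∀ᶠ z in 𝓝 (0 : ℂ), Summable fun n => b n * cyl μ n z := by
  obtain ⟨K, hK, hb⟩ := hb
  have : Tendsto (fun z : ℂ => K * ‖z‖) (𝓝 0) (𝓝 (K * ‖(0 : ℂ)‖)) :=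
    (continuous_norm.const_mul K).tendsto 0
  filter_upwards [this.eventually_lt_const (show K * ‖(0 : ℂ)‖ < 1 by simp)] with z hz
  exact summable_term_cyl hK hb hz

lemma CylAdmissible.eventually_differentiable {b : ℕ → ℂ} (hb : CylAdmissible b) (μ : ℝ) :
    ∀ᶠ z in 𝓝 (0 : ℂ), DifferentiableAt ℝ (cylSum μ b) z ∧
      ∀ v, HasSum (fun n => (b n * cylDeriv μ n z v).re) (fderiv ℝ (cylSum μ b) z v) := by
  obtain ⟨K, hK, hb⟩ := hb
  have : Tendsto (fun z : ℂ => K * ‖z‖) (𝓝 0) (𝓝 (K * ‖(0 : ℂ)‖)) :=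
    (continuous_norm.const_mul K).tendsto 0
  filter_upwards [this.eventually_lt_const (show K * ‖(0 : ℂ)‖ < 1 / 4 by simp)] with z hz
  exact ⟨(hasFDerivAt_cylSum hK hb hz).1.differentiableAt, fderiv_cylSum_apply hK hb hz⟩

lemma CylAdmissible.eventually_fderiv_rotation {b : ℕ → ℂ} (hb : CylAdmissible b) (μ : ℝ) :
    ∀ᶠ z in 𝓝 (0 : ℂ), fderiv ℝ (cylSum μ b) z (Complex.I * z) =
      cylSum μ (fun n => Complex.I * n * b n) z := by
  filter_upwards [hb.eventually_differentiable μ] with z hz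
  rw [← (hz.2 (Complex.I * z)).tsum_eq, cylSum]
  refine tsum_congr fun n => ?_
  rw [cylDeriv_rotation]
  congr 1
  ring

lemma cylSum_add {μ : ℝ} {b c : ℕ → ℂ} {z : ℂ} (hb : Summable fun n => b n * cyl μ n z)
    (hc : Summable fun n => c n * cyl μ n z) :
    cylSum μ (b + c) z = cylSum μ b z + cylSum μ c z := by
  rw [cylSum, cylSum, cylSum,
    ← hb.complex_re.tsum_add hc.complex_re]
  refine tsum_congr fun n => ?_
  simp [add_mul]

/-- Differentiate termwise by the ladder relations and collect equal indices. Index 1 is special in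
`cylShift`: the term of index 0 enters through Re b₀ only, and its derivative, the sum of two
conjugates, gives 2 Re b₀. -/
lemma CylAdmissible.eventually_fderiv {b : ℕ → ℂ} (hb : CylAdmissible b) (μ : ℝ) (v : ℂ) :
    ∀ᶠ z in 𝓝 (0 : ℂ), fderiv ℝ (cylSum μ b) z v = cylSum μ (cylShift μ v b) z := by
  have h1 : CylAdmissible fun n => v * b (n + 1) :=
    hb.succ.of_norm_le (C := ‖v‖) fun n => by rw [norm_mul]
  filter_upwards [hb.eventually_differentiable μ, h1.eventually_summable μ,
    (hb.shift μ v).eventually_summable μ] with z hz hs1 hs2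
  have hd := hz.2 v
  have hA := hs1.complex_re
  have hS := hs2.complex_re
  have hB : Summable fun n => ((cylShift μ v b n - v * b (n + 1)) * cyl μ n z).re := by
    refine (hS.sub hA).congr fun n => ?_
    simp [sub_mul]
  have hB1 := (summable_nat_add_iff (f := fun n =>
    ((cylShift μ v b n - v * b (n + 1)) * cyl μ n z).re) 1).2 hB
  have e1 : cylSum μ (cylShift μ v b) z = (∑' n, (v * b (n + 1) * cyl μ n z).re) +
      ∑' n, ((cylShift μ v b n - v * b (n + 1)) * cyl μ n z).re := by
    rw [← Summable.tsum_add hA hB, cylSum]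
    refine tsum_congr fun n => ?_
    simp [sub_mul]
  rw [e1, hB.tsum_eq_zero_add, hB1.tsum_eq_zero_add, ← hd.tsum_eq, hd.summable.tsum_eq_zero_add]
  have e2 : ∀ n, (b (n + 1) * cylDeriv μ (n + 1) z v).re = (v * b (n + 1) * cyl μ n z).re +
      ((cylShift μ v b (n + 1 + 1) - v * b (n + 1 + 1 + 1)) * cyl μ (n + 1 + 1) z).re := by
    intro n
    rw [cylDeriv_succ, ← Complex.add_re]
    simp only [cylShift]
    congr 1
    ring
  rw [tsum_congr e2, Summable.tsum_add hA ((summable_nat_add_iff (f := fun n =>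
    ((cylShift μ v b (n + 1) - v * b (n + 1 + 1)) * cyl μ (n + 1) z).re) 1).2 hB1),
    cylDeriv_zero]
  simp only [cylShift, zero_add, sub_self, zero_mul, Complex.zero_re, add_sub_cancel_left]
  rw [add_left_comm]
  congr 2
  rw [Complex.add_conj]
  simp
  ring

/-! ### Expansions at a point and leading harmonic terms -/

/-- `g` is near `0` the real part of a convergent series of cylindrical solutions. -/
def HasCylExpansion (μ : ℝ) (g : ℂ → ℝ) : Prop :=
  ∃ b, CylAdmissible b ∧ g =ᶠ[𝓝 0] cylSum μ b

/-- The field i(z − q) is the rotation iz about 0 plus a constant field. The first multiplies the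
coefficients by in, the second acts by `cylShift`. -/
lemma HasCylExpansion.rotation {μ : ℝ} {g : ℂ → ℝ} (hg : HasCylExpansion μ g) (q : ℂ) :
    HasCylExpansion μ fun z => fderiv ℝ g z (Complex.I * (z - q)) := by
  obtain ⟨b, hb, hgb⟩ := hg
  have hr := hb.rotation
  have hs := hb.shift μ (-(Complex.I * q))
  refine ⟨_, hr.add hs, ?_⟩
  filter_upwards [hgb.eventuallyEq_nhds, hb.eventually_fderiv_rotation μ,
    hb.eventually_fderiv μ (-(Complex.I * q)), hr.eventually_summable μ,
    hs.eventually_summable μ] with z h1 h2 h3 h4 h5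
  rw [h1.fderiv_eq, cylSum_add h4 h5, ← h2, ← h3, ← map_add]
  congr 1
  ring

lemma cyl_sub_isBigO (μ : ℝ) (M : ℕ) :
    (fun z : ℂ => cyl μ M z - z ^ M / M.factorial) =O[𝓝 0] fun z => ‖z‖ ^ (M + 1) := by
  have h1 : (fun s : ℝ => besselE μ M s - (M.factorial : ℝ)⁻¹) =O[𝓝 0] fun s => s := by
    have := (hasDerivAt_besselE μ M 0).isBigO_sub
    simpa [besselE_zero_right] using this
  have h2 : Tendsto (fun z : ℂ => Complex.normSq z) (𝓝 0) (𝓝 0) := by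
    simpa using Complex.continuous_normSq.tendsto 0
  have h3 : (fun z : ℂ => ((besselE μ M (Complex.normSq z) - (M.factorial : ℝ)⁻¹ : ℝ) : ℂ))
      =O[𝓝 0] fun z : ℂ => ‖z‖ := by
    refine (Complex.isBigO_ofReal_left.2 (h1.comp_tendsto h2)).trans ?_
    simp only [Function.comp_def, Complex.normSq_eq_norm_sq]
    refine IsBigO.of_bound 1 ?_
    filter_upwards [Metric.closedBall_mem_nhds (0 : ℂ) one_pos] with z hz
    have hz : ‖z‖ ≤ 1 := by simpa using hz
    simp only [norm_pow, norm_norm, one_mul]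
    nlinarith [norm_nonneg z]
  have h4 : (fun z : ℂ => z ^ M) =O[𝓝 0] fun z => ‖z‖ ^ M :=
    IsBigO.of_bound 1 (by simp)
  refine (h4.mul h3).congr (fun z => ?_) fun z => ?_
  · rw [cyl]; push_cast; ring
  · rw [pow_succ]

lemma cylSum_sub_isBigO {b : ℕ → ℂ} (hb : CylAdmissible b) (μ : ℝ) (M : ℕ)
    (h0 : ∀ n < M, b n = 0) :
    (fun z => cylSum μ b z - (b M * z ^ M / M.factorial).re) =O[𝓝 0] fun z => ‖z‖ ^ (M + 1) := by
  have h1 : (fun z => (b M * (cyl μ M z - z ^ M / M.factorial)).re) =O[𝓝 0]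
      fun z => ‖z‖ ^ (M + 1) :=
    (Complex.reCLM.isBigO_comp _ _).trans ((cyl_sub_isBigO μ M).const_mul_left (b M))
  obtain ⟨K, hK, hb'⟩ := id hb
  have h2 : (fun z => ∑' n, (b (n + (M + 1)) * cyl μ (n + (M + 1)) z).re) =O[𝓝 0]
      fun z => ‖z‖ ^ (M + 1) := by
    refine IsBigO.of_bound (2 * (K * Real.exp |μ| * K ^ (M + 1))) ?_
    have : Tendsto (fun z : ℂ => K * ‖z‖) (𝓝 0) (𝓝 (K * ‖(0 : ℂ)‖)) :=
      (continuous_norm.const_mul K).tendsto 0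
    filter_upwards [this.eventually_lt_const (show K * ‖(0 : ℂ)‖ < 1 / 2 by simp)] with z hz
    have hz1 : ‖z‖ ≤ 1 := by nlinarith [norm_nonneg z]
    have hgeo := hasSum_geometric_two.mul_left (K * Real.exp |μ| * K ^ (M + 1) * ‖z‖ ^ (M + 1))
    refine (tsum_of_norm_bounded hgeo fun n => ?_).trans (le_of_eq ?_)
    · rw [Real.norm_eq_abs]
      refine (Complex.abs_re_le_norm _).trans ((norm_term_cyl_le hK hb' hz1 _).trans ?_)
      rw [pow_add, mul_pow K ‖z‖ (M + 1)]
      have : (K * ‖z‖) ^ n ≤ (1 / 2 : ℝ) ^ n := by gcongr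
      calc K * Real.exp |μ| * ((K * ‖z‖) ^ n * (K ^ (M + 1) * ‖z‖ ^ (M + 1)))
          ≤ K * Real.exp |μ| * ((1 / 2) ^ n * (K ^ (M + 1) * ‖z‖ ^ (M + 1))) := by gcongr
        _ = _ := by ring
    · rw [norm_pow, norm_norm]; ring
  refine (h1.add h2).congr' ?_ .rfl
  filter_upwards [hb.eventually_summable μ] with z hz
  rw [cylSum, ← hz.complex_re.sum_add_tsum_nat_add (M + 1), Finset.sum_range_succ,
    Finset.sum_eq_zero fun n hn => by rw [h0 n (Finset.mem_range.1 hn)]; simp]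
  rw [mul_sub, Complex.sub_re, mul_div_assoc]
  ring

/-- Near `0`, `g` agrees to first order with the harmonic polynomial `Re (A z ^ (m + 1))` of degree
`m + 1`, and so do the derivatives. -/
structure HasHarmonicLeadingTerm (g : ℂ → ℝ) (m : ℕ) (A : ℂ) : Prop where
  ne_zero : A ≠ 0
  differentiable : ∀ᶠ z in 𝓝 0, DifferentiableAt ℝ g z
  isBigO : (fun z => g z - (A * z ^ (m + 1)).re) =O[𝓝 0] fun z => ‖z‖ ^ (m + 2)
  isBigO_fderiv : ∀ v : ℂ, (fun z => fderiv ℝ g z v - ((m + 1) * A * z ^ m * v).re) =O[𝓝 0]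
    fun z => ‖z‖ ^ (m + 1)

/-- The first coefficient that counts decides. The derivative estimate needs no separate argument: a
directional derivative is again such a series, starting at index m with coefficient v b_(m+1). -/
lemma HasCylExpansion.trichotomy {μ : ℝ} {g : ℂ → ℝ} (hg : HasCylExpansion μ g) :
    g =ᶠ[𝓝 0] 0 ∨ g 0 ≠ 0 ∨ ∃ m A, HasHarmonicLeadingTerm g m A := by
  classical
  obtain ⟨b, hb, hgb⟩ := hg
  by_cases hre : (b 0).re = 0
  swap
  · refine .inr (.inl ?_)
    rw [hgb.eq_of_nhds, cylSum, tsum_eq_single 0]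
    · simpa [cyl, besselE_zero_right] using hre
    · intro n hn; simp [cyl, hn]
  by_cases hex : ∃ n, b (n + 1) ≠ 0
  swap
  · push Not at hex
    refine .inl (hgb.trans (.of_forall fun z => ?_))
    rw [cylSum, Pi.zero_apply]
    refine (tsum_congr fun n => ?_).trans tsum_zero
    rcases n with _ | n
    · simp [cyl, hre]
    · simp [hex]
  refine .inr (.inr ?_)
  set m := Nat.find hex with hm
  -- Im b₀ does not affect the sum but may be nonzero; as Re b₀ = 0, b₀ is replaced by 0.
  set c : ℕ → ℂ := fun n => if n = 0 then 0 else b n with hc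
  have hcadm : CylAdmissible c := hb.of_norm_le (C := 1) fun n => by
    by_cases hn : n = 0 <;> simp [hc, hn]
  have hgc : g =ᶠ[𝓝 0] cylSum μ c := hgb.trans <| .of_forall fun z => tsum_congr fun n => by
    by_cases hn : n = 0
    · subst hn; simp [hc, cyl, hre]
    · simp [hc, hn]
  have hc0 : ∀ n < m + 1, c n = 0 := by
    intro n hn
    rcases n with _ | n
    · simp [hc]
    · have := Nat.find_min hex (m := n) (by omega)
      simpa [hc] using this
  have hcm : c (m + 1) = b (m + 1) := by simp [hc]
  have hf : ((m + 1).factorial : ℂ) ≠ 0 := by exact_mod_cast Nat.factorial_ne_zero _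
  refine ⟨m, b (m + 1) / (m + 1).factorial, div_ne_zero (Nat.find_spec hex) hf, ?_, ?_, ?_⟩
  · filter_upwards [hgc.eventuallyEq_nhds, hcadm.eventually_differentiable μ] with z h1 h2
    exact h2.1.congr_of_eventuallyEq h1
  · refine (cylSum_sub_isBigO hcadm μ (m + 1) hc0).congr' ?_ .rfl
    filter_upwards [hgc] with z hz
    rw [hz, hcm]
    congr 2
    ring
  · intro v
    have hs0 : ∀ n < m, cylShift μ v c n = 0 := by
      intro n hn
      rcases n with _ | _ | n <;> simp only [cylShift]
      · rw [hc0 1 (by omega), mul_zero]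
      · rw [hc0 2 (by omega), hc0 0 (by omega)]; simp
      · rw [hc0 (n + 3) (by omega), hc0 (n + 1) (by omega)]; simp
    have hsm : cylShift μ v c m = v * b (m + 1) := by
      rw [← hcm]
      clear_value m
      rcases m with _ | _ | n <;> simp only [cylShift]
      · rw [hc0 0 (by omega)]; simp
      · rw [hc0 (n + 1) (by omega)]; simp
    refine (cylSum_sub_isBigO (hcadm.shift μ v) μ m hs0).congr' ?_ .rfl
    filter_upwards [hgc.eventuallyEq_nhds, hcadm.eventually_fderiv μ v] with z h1 h2
    rw [h1.fderiv_eq, h2, hsm]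
    congr 2
    have : (m.factorial : ℂ) ≠ 0 := by exact_mod_cast Nat.factorial_ne_zero _
    rw [Nat.factorial_succ]
    push_cast
    have : (m : ℂ) + 1 ≠ 0 := by exact_mod_cast Nat.succ_ne_zero m
    field_simp

/-! ### Fourier coefficients on circles -/

lemma hasDerivAt_intervalIntegral_param {F F' : ℝ → ℝ → ℂ} {R a b r : ℝ}
    (hF : ∀ r ∈ Ioo (-R) R, ∀ θ, HasDerivAt (F · θ) (F' r θ) r)
    (hFc : ∀ r ∈ Ioo (-R) R, Continuous (F r))
    (hF' : ContinuousOn (fun p : ℝ × ℝ => F' p.1 p.2) (Ioo (-R) R ×ˢ univ))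
    (hr : r ∈ Ioo (-R) R) :
    HasDerivAt (fun r => ∫ θ in a..b, F r θ) (∫ θ in a..b, F' r θ) r := by
  obtain ⟨δ, hδ, hsub⟩ := Metric.nhds_basis_closedBall.mem_iff.1 (isOpen_Ioo.mem_nhds hr)
  have hcomp : IsCompact (Metric.closedBall r δ ×ˢ uIcc a b) :=
    (isCompact_closedBall r δ).prod isCompact_uIcc
  obtain ⟨C, hC⟩ := hcomp.exists_bound_of_continuousOn
    (hF'.mono (prod_mono hsub (subset_univ _)))
  refine (intervalIntegral.hasDerivAt_integral_of_dominated_loc_of_deriv_le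
    (F := F) (F' := F') (bound := fun _ => C) (s := Metric.closedBall r δ)
    (Metric.closedBall_mem_nhds r hδ) ?_ ?_ ?_ ?_ ?_ ?_).2
  · filter_upwards [isOpen_Ioo.mem_nhds hr] with x hx
    exact (hFc x hx).aestronglyMeasurable
  · exact (hFc r hr).intervalIntegrable _ _
  · have : Continuous (F' r) := by
      refine continuousOn_univ.1 ?_
      exact hF'.comp (f := fun θ : ℝ => (r, θ)) (by fun_prop) fun θ _ => ⟨hr, mem_univ _⟩
    exact this.aestronglyMeasurable
  · refine .of_forall fun θ hθ x hx => hC (x, θ) ⟨hx, uIoc_subset_uIcc hθ⟩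
  · simp
  · exact .of_forall fun θ _ x hx => hF x (hsub hx) θ

/-- The unit vector at angle `θ`. -/
noncomputable def unitAt (θ : ℝ) : ℂ := Complex.exp (θ * Complex.I)

lemma norm_unitAt (θ : ℝ) : ‖unitAt θ‖ = 1 := Complex.norm_exp_ofReal_mul_I θ

lemma hasDerivAt_unitAt (θ : ℝ) : HasDerivAt unitAt (Complex.I * unitAt θ) θ := by
  have : HasDerivAt (fun θ : ℝ => (θ : ℂ) * Complex.I) (1 * Complex.I) θ :=
    Complex.ofRealCLM.hasDerivAt.mul_const Complex.I
  refine this.cexp.congr_deriv ?_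
  rw [unitAt]; ring

@[fun_prop]
lemma continuous_unitAt : Continuous unitAt :=
  continuous_iff_continuousAt.2 fun θ => (hasDerivAt_unitAt θ).continuousAt

lemma unitAt_add_two_pi (θ : ℝ) : unitAt (θ + 2 * Real.pi) = unitAt θ := by
  rw [unitAt, unitAt]; push_cast
  rw [add_mul, Complex.exp_add, Complex.exp_two_pi_mul_I, mul_one]

lemma norm_ofReal_mul_unitAt (r θ : ℝ) : ‖(r : ℂ) * unitAt θ‖ = |r| := by
  rw [norm_mul, norm_unitAt, mul_one, Complex.norm_real, Real.norm_eq_abs]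

/-- The angular factor `e ^ (-i n θ)`. -/
noncomputable def angFactor (n : ℕ) (θ : ℝ) : ℂ := Complex.exp (-(n * θ * Complex.I))

lemma hasDerivAt_angFactor (n : ℕ) (θ : ℝ) :
    HasDerivAt (angFactor n) (-(n * Complex.I) * angFactor n θ) θ := by
  have : HasDerivAt (fun θ : ℝ => -((n : ℂ) * θ * Complex.I)) (-((n : ℂ) * 1 * Complex.I)) θ :=
    ((Complex.ofRealCLM.hasDerivAt.const_mul (n : ℂ)).mul_const Complex.I).neg
  refine this.cexp.congr_deriv ?_
  rw [angFactor]; ring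

@[fun_prop]
lemma continuous_angFactor (n : ℕ) : Continuous (angFactor n) :=
  continuous_iff_continuousAt.2 fun θ => (hasDerivAt_angFactor n θ).continuousAt

lemma norm_angFactor (n : ℕ) (θ : ℝ) : ‖angFactor n θ‖ = 1 := by
  rw [angFactor, show -((n : ℂ) * θ * Complex.I) = ((-(n * θ) : ℝ) : ℂ) * Complex.I by
    push_cast; ring]
  exact Complex.norm_exp_ofReal_mul_I _

lemma angFactor_add_two_pi (n : ℕ) (θ : ℝ) : angFactor n (θ + 2 * Real.pi) = angFactor n θ := by
  rw [angFactor, angFactor, Complex.exp_eq_exp_iff_exists_int]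
  exact ⟨-n, by push_cast; ring⟩

section Polar

variable {W : ℂ → ℝ} {R : ℝ}

/-- The `n`-th (unnormalized) Fourier coefficient of `W` on the circle of radius `r`. -/
noncomputable def circleCoeff (W : ℂ → ℝ) (n : ℕ) (r : ℝ) : ℂ :=
  ∫ θ in (0 : ℝ)..2 * Real.pi, (W (r * unitAt θ) : ℂ) * angFactor n θ

/-- The first radial derivative of `circleCoeff`. -/
noncomputable def circleCoeffDeriv (W : ℂ → ℝ) (n : ℕ) (r : ℝ) : ℂ :=
  ∫ θ in (0 : ℝ)..2 * Real.pi, (fderiv ℝ W (r * unitAt θ) (unitAt θ) : ℂ) * angFactor n θ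

/-- The second radial derivative of `circleCoeff`. -/
noncomputable def circleCoeffDeriv₂ (W : ℂ → ℝ) (n : ℕ) (r : ℝ) : ℂ :=
  ∫ θ in (0 : ℝ)..2 * Real.pi,
    (fderiv ℝ (fderiv ℝ W) (r * unitAt θ) (unitAt θ) (unitAt θ) : ℂ) * angFactor n θ

lemma polar_mem {r : ℝ} (hr : r ∈ Ioo (-R) R) (θ : ℝ) :
    (r : ℂ) * unitAt θ ∈ Metric.ball (0 : ℂ) R := by
  rw [mem_ball_zero_iff, norm_ofReal_mul_unitAt]
  exact abs_lt.2 hr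

lemma continuousOn_polar {E : Type*} [TopologicalSpace E] {G : ℂ → E}
    (hG : ContinuousOn G (Metric.ball 0 R)) :
    ContinuousOn (fun p : ℝ × ℝ => G (p.1 * unitAt p.2)) (Ioo (-R) R ×ˢ univ) :=
  hG.comp (by fun_prop) fun p hp => polar_mem hp.1 p.2

lemma continuous_polar {E : Type*} [TopologicalSpace E] {G : ℂ → E}
    (hG : ContinuousOn G (Metric.ball 0 R)) {r : ℝ} (hr : r ∈ Ioo (-R) R) :
    Continuous (fun θ : ℝ => G (r * unitAt θ)) :=
  continuousOn_univ.1 <| hG.comp (by fun_prop) fun θ _ => polar_mem hr θ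

lemma hasDerivAt_radial {F : Type*} [NormedAddCommGroup F] [NormedSpace ℝ F] {G : ℂ → F} {r θ : ℝ}
    (hG : DifferentiableAt ℝ G (r * unitAt θ)) :
    HasDerivAt (fun r : ℝ => G (r * unitAt θ)) (fderiv ℝ G (r * unitAt θ) (unitAt θ)) r := by
  have h : HasDerivAt (fun r : ℝ => (r : ℂ) * unitAt θ) (unitAt θ) r := by
    simpa using Complex.ofRealCLM.hasDerivAt (x := r) |>.mul_const (unitAt θ)
  exact hG.hasFDerivAt.comp_hasDerivAt r h

lemma hasDerivAt_angular {F : Type*} [NormedAddCommGroup F] [NormedSpace ℝ F] {G : ℂ → F} {r θ : ℝ}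
    (hG : DifferentiableAt ℝ G (r * unitAt θ)) :
    HasDerivAt (fun θ : ℝ => G (r * unitAt θ))
      (fderiv ℝ G (r * unitAt θ) (r * (Complex.I * unitAt θ))) θ :=
  hG.hasFDerivAt.comp_hasDerivAt θ ((hasDerivAt_unitAt θ).const_mul (r : ℂ))

lemma ContDiffOn.differentiableAt_ball (hW : ContDiffOn ℝ 2 W (Metric.ball 0 R))
    {z : ℂ} (hz : z ∈ Metric.ball (0 : ℂ) R) :
    DifferentiableAt ℝ W z :=
  (hW.contDiffAt (Metric.isOpen_ball.mem_nhds hz)).differentiableAt (by norm_num)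

lemma ContDiffOn.fderiv_ball (hW : ContDiffOn ℝ 2 W (Metric.ball 0 R)) :
    ContDiffOn ℝ 1 (fderiv ℝ W) (Metric.ball 0 R) :=
  hW.fderiv_of_isOpen Metric.isOpen_ball (by norm_num)

lemma ContDiffOn.differentiableAt_fderiv_ball (hW : ContDiffOn ℝ 2 W (Metric.ball 0 R))
    {z : ℂ} (hz : z ∈ Metric.ball (0 : ℂ) R) :
    DifferentiableAt ℝ (fderiv ℝ W) z :=
  (hW.fderiv_ball.contDiffAt (Metric.isOpen_ball.mem_nhds hz)).differentiableAt (by norm_num)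

lemma ContDiffOn.continuousOn_fderiv_fderiv_ball (hW : ContDiffOn ℝ 2 W (Metric.ball 0 R)) :
    ContinuousOn (fderiv ℝ (fderiv ℝ W)) (Metric.ball 0 R) :=
  hW.fderiv_ball.continuousOn_fderiv_of_isOpen Metric.isOpen_ball (by norm_num)

lemma hasDerivAt_circleCoeff (hW : ContDiffOn ℝ 2 W (Metric.ball 0 R))
    (n : ℕ) {r : ℝ} (hr : r ∈ Ioo (-R) R) :
    HasDerivAt (circleCoeff W n) (circleCoeffDeriv W n r) r := by
  refine hasDerivAt_intervalIntegral_param (R := R)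
    (F := fun r θ => (W (r * unitAt θ) : ℂ) * angFactor n θ)
    (F' := fun r θ => (fderiv ℝ W (r * unitAt θ) (unitAt θ) : ℂ) * angFactor n θ)
    (fun r hr θ => ?_) (fun r hr => ?_) ?_ hr
  · exact (hasDerivAt_radial (hW.differentiableAt_ball (polar_mem hr θ))).ofReal_comp.mul_const _
  · exact (Complex.continuous_ofReal.comp (continuous_polar hW.continuousOn hr)).mul
      (continuous_angFactor n)
  · have := continuousOn_polar hW.fderiv_ball.continuousOn
    have h2 : ContinuousOn (fun p : ℝ × ℝ => fderiv ℝ W (p.1 * unitAt p.2) (unitAt p.2))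
      (Ioo (-R) R ×ˢ univ) := this.clm_apply (by fun_prop)
    exact (Complex.continuous_ofReal.comp_continuousOn h2).mul (by fun_prop)

lemma hasDerivAt_circleCoeffDeriv (hW : ContDiffOn ℝ 2 W (Metric.ball 0 R))
    (n : ℕ) {r : ℝ} (hr : r ∈ Ioo (-R) R) :
    HasDerivAt (circleCoeffDeriv W n) (circleCoeffDeriv₂ W n r) r := by
  refine hasDerivAt_intervalIntegral_param (R := R)
    (F := fun r θ => (fderiv ℝ W (r * unitAt θ) (unitAt θ) : ℂ) * angFactor n θ)
    (F' := fun r θ =>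
      (fderiv ℝ (fderiv ℝ W) (r * unitAt θ) (unitAt θ) (unitAt θ) : ℂ) * angFactor n θ)
    (fun r hr θ => ?_) (fun r hr => ?_) ?_ hr
  · have h := hasDerivAt_radial (hW.differentiableAt_fderiv_ball (polar_mem hr θ))
    have h2 := h.clm_apply (hasDerivAt_const r (unitAt θ))
    simp only [map_zero, add_zero] at h2
    exact h2.ofReal_comp.mul_const _
  · have := continuous_polar hW.fderiv_ball.continuousOn hr
    fun_prop
  · have := continuousOn_polar hW.continuousOn_fderiv_fderiv_ball
    have h2 : ContinuousOn (fun p : ℝ × ℝ =>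
        fderiv ℝ (fderiv ℝ W) (p.1 * unitAt p.2) (unitAt p.2) (unitAt p.2))
      (Ioo (-R) R ×ˢ univ) := (this.clm_apply (by fun_prop)).clm_apply (by fun_prop)
    exact (Complex.continuous_ofReal.comp_continuousOn h2).mul (by fun_prop)

/-- In polar coordinates the equation reads r² W_rr + r W_r + W_θθ = 4μ r² W. Integrated against
e^(−inθ), the term W_θθ becomes −n² times the coefficient, since the boundary terms cancel by
periodicity. -/
lemma circleCoeff_ode {μ : ℝ} (hW : ContDiffOn ℝ 2 W (Metric.ball 0 R))
    (hΔ : ∀ z ∈ Metric.ball (0 : ℂ) R, fderiv ℝ (fderiv ℝ W) z 1 1 +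
      fderiv ℝ (fderiv ℝ W) z Complex.I Complex.I = 4 * μ * W z)
    (n : ℕ) {r : ℝ} (hr : r ∈ Ioo (-R) R) :
    r ^ 2 * circleCoeffDeriv₂ W n r + r * circleCoeffDeriv W n r
      = (n ^ 2 + 4 * μ * r ^ 2) * circleCoeff W n r := by
  have c0 := continuous_polar hW.continuousOn hr
  have c1 := continuous_polar hW.fderiv_ball.continuousOn hr
  have c2 := continuous_polar hW.continuousOn_fderiv_fderiv_ball hr
  -- a periodic primitive of `(W_θθ + n ^ 2 W) e ^ (- i n θ)`
  have hprim : ∀ θ : ℝ, HasDerivAt (fun θ : ℝ =>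
      ((fderiv ℝ W (r * unitAt θ) (r * (Complex.I * unitAt θ)) : ℝ) : ℂ) * angFactor n θ
        + n * Complex.I * ((W (r * unitAt θ) : ℂ) * angFactor n θ))
      ((n ^ 2 + 4 * μ * r ^ 2) * ((W (r * unitAt θ) : ℂ) * angFactor n θ)
        - r ^ 2 * ((fderiv ℝ (fderiv ℝ W) (r * unitAt θ) (unitAt θ) (unitAt θ) : ℂ) * angFactor n θ)
        - r * ((fderiv ℝ W (r * unitAt θ) (unitAt θ) : ℂ) * angFactor n θ)) θ := by
    intro θ
    have hz := polar_mem hr θ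
    have h0 := (hasDerivAt_angular (hW.differentiableAt_ball hz)).ofReal_comp
    have hv : HasDerivAt (fun θ : ℝ => (r : ℂ) * (Complex.I * unitAt θ))
      (r * (Complex.I * (Complex.I * unitAt θ))) θ :=
      ((hasDerivAt_unitAt θ).const_mul Complex.I).const_mul (r : ℂ)
    have h1 := ((hasDerivAt_angular (hW.differentiableAt_fderiv_ball hz)).clm_apply hv).ofReal_comp
    have h2 := (h1.mul (hasDerivAt_angFactor n θ)).add
      ((h0.mul (hasDerivAt_angFactor n θ)).const_mul (n * Complex.I : ℂ))
    refine h2.congr_deriv ?_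
    set D := fderiv ℝ (fderiv ℝ W) (r * unitAt θ) with hD
    -- The trace of the Hessian may be computed in the rotated orthonormal basis.
    have htr : D (unitAt θ) (unitAt θ) + D (Complex.I * unitAt θ) (Complex.I * unitAt θ)
        = 4 * μ * W (r * unitAt θ) := by
      rw [← hΔ _ hz]
      have e1 : unitAt θ = Real.cos θ • (1 : ℂ) + Real.sin θ • Complex.I := by
        rw [unitAt, Complex.exp_mul_I]; simp
      have e2 : Complex.I * unitAt θ = Real.cos θ • Complex.I - Real.sin θ • (1 : ℂ) := by
        rw [e1, mul_add, mul_smul_comm, mul_smul_comm, Complex.I_mul_I]; simp [sub_eq_add_neg]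
      rw [← hD, e2, e1]
      simp only [map_add, map_sub, map_smul, add_apply,
        sub_apply, smul_apply, smul_eq_mul]
      linear_combination (D 1 1 + D Complex.I Complex.I) * Real.sin_sq_add_cos_sq θ
    have e3 : D (r * (Complex.I * unitAt θ)) (r * (Complex.I * unitAt θ))
        = r ^ 2 * (4 * μ * W (r * unitAt θ) - D (unitAt θ) (unitAt θ)) := by
      rw [← htr, ← Complex.real_smul, map_smul, map_smul, smul_apply,
        smul_eq_mul, smul_eq_mul]
      ring
    have e4 : (r : ℂ) * (Complex.I * (Complex.I * unitAt θ)) = (-r) • unitAt θ := by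
      rw [← mul_assoc Complex.I, Complex.I_mul_I]; simp
    rw [e3, e4, map_smul, smul_eq_mul]
    push_cast
    linear_combination (-(n : ℂ) ^ 2 * W (r * unitAt θ) * angFactor n θ) * Complex.I_sq
  have hi0 : IntervalIntegrable (fun θ : ℝ => (W (r * unitAt θ) : ℂ) * angFactor n θ)
      MeasureTheory.volume 0 (2 * Real.pi) :=
    ((Complex.continuous_ofReal.comp c0).mul (continuous_angFactor n)).intervalIntegrable _ _
  have hi1 : IntervalIntegrable (fun θ : ℝ =>
      (fderiv ℝ W (r * unitAt θ) (unitAt θ) : ℂ) * angFactor n θ)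
      MeasureTheory.volume 0 (2 * Real.pi) := Continuous.intervalIntegrable (by fun_prop) _ _
  have hi2 : IntervalIntegrable (fun θ : ℝ =>
      (fderiv ℝ (fderiv ℝ W) (r * unitAt θ) (unitAt θ) (unitAt θ) : ℂ) * angFactor n θ)
      MeasureTheory.volume 0 (2 * Real.pi) := Continuous.intervalIntegrable (by fun_prop) _ _
  have hint := intervalIntegral.integral_eq_sub_of_hasDerivAt (a := 0) (b := 2 * Real.pi)
    (fun θ _ => hprim θ)
    (((hi0.const_mul _).sub (hi2.const_mul _)).sub (hi1.const_mul _))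
  have hu := unitAt_add_two_pi 0
  have ha := angFactor_add_two_pi n 0
  rw [zero_add] at hu ha
  rw [hu, ha, sub_self, intervalIntegral.integral_sub ((hi0.const_mul _).sub (hi2.const_mul _))
    (hi1.const_mul _), intervalIntegral.integral_sub (hi0.const_mul _) (hi2.const_mul _),
    intervalIntegral.integral_const_mul, intervalIntegral.integral_const_mul,
    intervalIntegral.integral_const_mul] at hint
  rw [circleCoeff, circleCoeffDeriv, circleCoeffDeriv₂]
  linear_combination -hint

end Polar

/-! ### The radial equation and the Fourier–Bessel expansion -/

/-- The radial factor of `cyl μ n`. -/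
noncomputable def radial (μ : ℝ) (n : ℕ) (r : ℝ) : ℝ := r ^ n * besselE μ n (r ^ 2)

/-- `r` times the derivative of `radial μ n`. -/
noncomputable def radialEuler (μ : ℝ) (n : ℕ) (r : ℝ) : ℝ :=
  n * r ^ n * besselE μ n (r ^ 2) + 2 * μ * r ^ (n + 2) * besselE μ (n + 1) (r ^ 2)

lemma hasDerivAt_pow_mul_besselE (μ : ℝ) (m n : ℕ) (r : ℝ) :
    HasDerivAt (fun r => r ^ m * besselE μ n (r ^ 2))
      (m * r ^ (m - 1) * besselE μ n (r ^ 2) + r ^ m * (μ * besselE μ (n + 1) (r ^ 2) * (2 * r)))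
      r := by
  have h1 : HasDerivAt (fun r : ℝ => r ^ 2) (2 * r) r := by simpa using hasDerivAt_pow 2 r
  exact (hasDerivAt_pow m r).mul
    (HasDerivAt.comp (h₂ := besselE μ n) r (hasDerivAt_besselE μ n (r ^ 2)) h1)

lemma cast_mul_pow_pred_mul (n : ℕ) (r : ℝ) : n * r ^ (n - 1) * r = n * r ^ n := by
  rcases n with _ | n
  · simp
  · rw [Nat.add_sub_cancel, pow_succ]; ring

/-- With the next lemma, this is the radial equation as a first-order system for the Euler operator
r d/dr. Multiplying by r removes the exponent n − 1 and keeps r = 0 in scope. -/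
lemma exists_hasDerivAt_radial (μ : ℝ) (n : ℕ) (r : ℝ) :
    ∃ d, HasDerivAt (radial μ n) d r ∧ r * d = radialEuler μ n r := by
  refine ⟨_, hasDerivAt_pow_mul_besselE μ n n r, ?_⟩
  rw [radialEuler]
  linear_combination besselE μ n (r ^ 2) * cast_mul_pow_pred_mul n r

lemma exists_hasDerivAt_radialEuler (μ : ℝ) (n : ℕ) (r : ℝ) :
    ∃ d, HasDerivAt (radialEuler μ n) d r ∧ r * d = (n ^ 2 + 4 * μ * r ^ 2) * radial μ n r := by
  have h := ((hasDerivAt_pow_mul_besselE μ n n r).const_mul (n : ℝ)).add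
    ((hasDerivAt_pow_mul_besselE μ (n + 2) (n + 1) r).const_mul (2 * μ))
  refine ⟨_, h.congr_of_eventuallyEq (.of_forall fun x => ?_), ?_⟩
  · simp only [radialEuler, Pi.add_apply]; ring
  · rw [radial, show n + 2 - 1 = n + 1 from rfl]
    push_cast
    rw [show n + 1 + 1 = n + 2 from rfl]
    linear_combination n * besselE μ n (r ^ 2) * cast_mul_pow_pred_mul n r
      - 4 * μ * r ^ (n + 2) * besselE_eq μ n (r ^ 2)

/-- The bound 3/2 leaves 2 − 3/2 = 1/2 in `besselE_ge`. It serves both for dividing by the radial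
factor and for bounding the coefficients. -/
lemma radial_ge {μ r : ℝ} (hr : 0 ≤ r) (h : Real.exp |μ * r ^ 2| ≤ 3 / 2) (n : ℕ) :
    r ^ n / (2 * n.factorial) ≤ radial μ n r := by
  have h1 := besselE_ge μ (r ^ 2) n
  have h2 : 1 / (2 * (n.factorial : ℝ)) ≤ besselE μ n (r ^ 2) := by
    refine le_trans ?_ h1
    rw [← div_div]
    gcongr
    linarith
  calc _ = r ^ n * (1 / (2 * n.factorial)) := by ring
    _ ≤ _ := mul_le_mul_of_nonneg_left h2 (by positivity)

section Expansion

variable {W : ℂ → ℝ} {R μ : ℝ}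

/-- The coefficient and the radial factor solve the same equation, so r times their Wronskian is
constant on (0, R). It tends to 0 at r = 0 because `W` is C² there, which excludes the singular
Bessel solution. -/
lemma wronskian_eq_zero (hW : ContDiffOn ℝ 2 W (Metric.ball 0 R))
    (hΔ : ∀ z ∈ Metric.ball (0 : ℂ) R, fderiv ℝ (fderiv ℝ W) z 1 1 +
      fderiv ℝ (fderiv ℝ W) z Complex.I Complex.I = 4 * μ * W z)
    (n : ℕ) {r : ℝ} (hr : r ∈ Ioo 0 R) :
    r * circleCoeffDeriv W n r * radial μ n r - circleCoeff W n r * radialEuler μ n r = 0 := by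
  set K : ℝ → ℂ := fun r =>
    r * circleCoeffDeriv W n r * radial μ n r - circleCoeff W n r * radialEuler μ n r with hK
  have hsub : Ioo 0 R ⊆ Ioo (-R) R := fun x hx => ⟨by linarith [hx.1, hx.2], hx.2⟩
  have hderiv : ∀ x ∈ Ioo (-R) R, ∃ d : ℂ, HasDerivAt K d x ∧ x * d = 0 := by
    intro x hx
    obtain ⟨p, hp, hpx⟩ := exists_hasDerivAt_radial μ n x
    obtain ⟨e, he, hex⟩ := exists_hasDerivAt_radialEuler μ n x
    have hid : HasDerivAt (fun r : ℝ => (r : ℂ)) 1 x := Complex.ofRealCLM.hasDerivAt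
    have h := ((hid.mul (hasDerivAt_circleCoeffDeriv hW n hx)).mul hp.ofReal_comp).sub
      ((hasDerivAt_circleCoeff hW n hx).mul he.ofReal_comp)
    refine ⟨_, h, ?_⟩
    have hode := circleCoeff_ode hW hΔ n hx
    have hpx' : (x : ℂ) * p = radialEuler μ n x := by exact_mod_cast hpx
    have hex' : (x : ℂ) * e = (n ^ 2 + 4 * μ * x ^ 2) * radial μ n x := by exact_mod_cast hex
    simp only [Pi.mul_apply]
    linear_combination (radial μ n x : ℂ) * hode + x * circleCoeffDeriv W n x * hpx'
      - circleCoeff W n x * hex'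
  have hR : 0 < R := hr.1.trans hr.2
  obtain ⟨C, hC⟩ := isOpen_Ioo.exists_is_const_of_deriv_eq_zero (s := Ioo 0 R) (f := K)
    isPreconnected_Ioo
    (fun x hx => by
      obtain ⟨d, hd, -⟩ := hderiv x (hsub hx)
      exact hd.differentiableAt.differentiableWithinAt)
    (fun x hx => by
      obtain ⟨d, hd, hd0⟩ := hderiv x (hsub hx)
      have hx0 : (x : ℂ) ≠ 0 := by exact_mod_cast hx.1.ne'
      rw [hd.deriv, (mul_eq_zero.1 hd0).resolve_left hx0, Pi.zero_apply])
  have hK0 : Tendsto K (𝓝[>] 0) (𝓝 0) := by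
    obtain ⟨d, hd, -⟩ := hderiv 0 ⟨by linarith, hR⟩
    have hz : K 0 = 0 := by
      simp only [hK, radialEuler]
      rcases n with _ | n <;> simp
    have := hd.continuousAt.tendsto
    rw [hz] at this
    exact this.mono_left nhdsWithin_le_nhds
  have hKC : Tendsto K (𝓝[>] 0) (𝓝 C) := by
    refine tendsto_const_nhds.congr' ?_
    filter_upwards [Ioo_mem_nhdsGT hR] with x hx using (hC x hx).symm
  exact (hC r hr).trans (tendsto_nhds_unique hKC hK0)

/-- A vanishing Wronskian makes the quotient by the radial factor constant. The constant is read off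
at ρ/2, and r = 0 follows by continuity. -/
lemma circleCoeff_eq (hW : ContDiffOn ℝ 2 W (Metric.ball 0 R))
    (hΔ : ∀ z ∈ Metric.ball (0 : ℂ) R, fderiv ℝ (fderiv ℝ W) z 1 1 +
      fderiv ℝ (fderiv ℝ W) z Complex.I Complex.I = 4 * μ * W z)
    (n : ℕ) {ρ : ℝ} (hρ0 : 0 < ρ) (hρR : ρ < R) (hρ : ∀ r ∈ Icc 0 ρ, Real.exp |μ * r ^ 2| ≤ 3 / 2)
    {r : ℝ} (hr : r ∈ Ico 0 ρ) :
    circleCoeff W n r = circleCoeff W n (ρ / 2) / radial μ n (ρ / 2) * radial μ n r := by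
  have hpos : ∀ x ∈ Ioo 0 ρ, 0 < radial μ n x := fun x hx =>
    lt_of_lt_of_le (by have := hx.1; positivity) (radial_ge hx.1.le (hρ x ⟨hx.1.le, hx.2.le⟩) n)
  have hsub : Ioo 0 ρ ⊆ Ioo (-R) R := fun x hx => ⟨by linarith [hx.1, hx.2], hx.2.trans hρR⟩
  have hq : ∀ x ∈ Ioo 0 ρ, HasDerivAt (fun r => circleCoeff W n r / (radial μ n r : ℂ)) 0 x := by
    intro x hx
    obtain ⟨p, hp, hpx⟩ := exists_hasDerivAt_radial μ n x
    have h0 : (radial μ n x : ℂ) ≠ 0 := by exact_mod_cast (hpos x hx).ne'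
    have hx0 : (x : ℂ) ≠ 0 := by exact_mod_cast hx.1.ne'
    have h := (hasDerivAt_circleCoeff hW n (hsub hx)).div hp.ofReal_comp h0
    refine h.congr_deriv ?_
    have hK := wronskian_eq_zero hW hΔ n ⟨hx.1, hx.2.trans hρR⟩
    have hpx' : (x : ℂ) * p = radialEuler μ n x := by exact_mod_cast hpx
    rw [div_eq_zero_iff]
    left
    refine (mul_eq_zero.1 (?_ : (x : ℂ) * _ = 0)).resolve_left hx0
    linear_combination hK - circleCoeff W n x * hpx'
  obtain ⟨C, hC⟩ := isOpen_Ioo.exists_is_const_of_deriv_eq_zero (s := Ioo 0 ρ)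
    isPreconnected_Ioo
    (fun x hx => (hq x hx).differentiableAt.differentiableWithinAt)
    (fun x hx => by rw [(hq x hx).deriv, Pi.zero_apply])
  have hmain : ∀ x ∈ Ioo 0 ρ,
      circleCoeff W n x = circleCoeff W n (ρ / 2) / radial μ n (ρ / 2) * radial μ n x := by
    intro x hx
    have h0 : (radial μ n x : ℂ) ≠ 0 := by exact_mod_cast (hpos x hx).ne'
    rw [hC (ρ / 2) ⟨by linarith, by linarith⟩, ← hC x hx, div_mul_cancel₀ _ h0]
  rcases hr.1.eq_or_lt with rfl | h0
  · have hR0 : (0 : ℝ) ∈ Ioo (-R) R := ⟨by linarith, by linarith⟩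
    have h1 := (hasDerivAt_circleCoeff hW n hR0).continuousAt.tendsto.mono_left
      (nhdsWithin_le_nhds (s := Ioi 0))
    obtain ⟨p, hp, -⟩ := exists_hasDerivAt_radial μ n 0
    have h2 := (hp.ofReal_comp.continuousAt.tendsto.mono_left
      (nhdsWithin_le_nhds (s := Ioi 0))).const_mul
        (circleCoeff W n (ρ / 2) / radial μ n (ρ / 2))
    refine tendsto_nhds_unique h1 (h2.congr' ?_)
    filter_upwards [Ioo_mem_nhdsGT hρ0] with x hx using (hmain x hx).symm
  · exact hmain r ⟨h0, hr.2⟩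

/-- `W` on the circle of radius `r`, as a function on the additive circle. -/
noncomputable def onCircle (W : ℂ → ℝ) (r : ℝ)
    (h : Continuous fun c : Circle => W (r * (c : ℂ))) : C(AddCircle (2 * Real.pi), ℂ) :=
  ⟨fun x => (W (r * (AddCircle.toCircle x : ℂ)) : ℂ),
    Complex.continuous_ofReal.comp (h.comp AddCircle.continuous_toCircle)⟩

instance fact_two_pi_pos : Fact (0 < 2 * Real.pi) := ⟨Real.two_pi_pos⟩

lemma toCircle_two_pi (θ : ℝ) :
    ((AddCircle.toCircle (θ : AddCircle (2 * Real.pi)) : Circle) : ℂ) = unitAt θ := by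
  rw [AddCircle.toCircle_apply_mk, div_self Real.two_pi_pos.ne', one_mul, Circle.coe_exp, unitAt]

lemma fourier_two_pi (n : ℕ) (θ : ℝ) :
    fourier (n : ℤ) (θ : AddCircle (2 * Real.pi)) = unitAt θ ^ n := by
  have : (Real.pi : ℂ) ≠ 0 := by exact_mod_cast Real.pi_pos.ne'
  rw [fourier_coe_apply, unitAt, ← Complex.exp_nat_mul]
  congr 1
  push_cast
  field_simp

lemma fourier_neg_two_pi (n : ℕ) (θ : ℝ) :
    fourier (-(n : ℤ)) (θ : AddCircle (2 * Real.pi)) = angFactor n θ := by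
  have : (Real.pi : ℂ) ≠ 0 := by exact_mod_cast Real.pi_pos.ne'
  rw [fourier_coe_apply, angFactor]
  congr 1
  push_cast
  field_simp

lemma fourierCoeff_onCircle {r : ℝ} (h : Continuous fun c : Circle => W (r * (c : ℂ))) (n : ℕ) :
    fourierCoeff (onCircle W r h) n = circleCoeff W n r / (2 * Real.pi) := by
  rw [fourierCoeff_eq_intervalIntegral _ _ 0, circleCoeff, zero_add, Complex.real_smul,
    one_div, Complex.ofReal_inv, Complex.ofReal_mul, Complex.ofReal_ofNat, inv_mul_eq_div]
  congr 1
  · refine intervalIntegral.integral_congr fun θ _ => ?_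
    simp only [fourier_neg_two_pi, onCircle, ContinuousMap.coe_mk, toCircle_two_pi, smul_eq_mul]
    ring

lemma fourierCoeff_onCircle_neg {r : ℝ} (h : Continuous fun c : Circle => W (r * (c : ℂ)))
    (n : ℤ) :
    fourierCoeff (onCircle W r h) (-n) = starRingEnd ℂ (fourierCoeff (onCircle W r h) n) := by
  rw [fourierCoeff, fourierCoeff, ← integral_conj]
  congr 1
  ext x
  simp only [smul_eq_mul, map_mul, ← fourier_neg, onCircle, ContinuousMap.coe_mk,
    Complex.conj_ofReal]

lemma cyl_polar (μ : ℝ) (n : ℕ) (r θ : ℝ) :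
    cyl μ n (r * unitAt θ) = radial μ n r * unitAt θ ^ n := by
  rw [cyl, Complex.normSq_eq_norm_sq, norm_ofReal_mul_unitAt, sq_abs, radial, mul_pow]
  push_cast
  ring

/-- A `C²` solution of `Δ W = 4 μ W` near the origin has an expansion in cylindrical solutions. -/
theorem hasCylExpansion_of_laplace (hR : 0 < R) (hW : ContDiffOn ℝ 2 W (Metric.ball 0 R))
    (hΔ : ∀ z ∈ Metric.ball (0 : ℂ) R, fderiv ℝ (fderiv ℝ W) z 1 1 +
      fderiv ℝ (fderiv ℝ W) z Complex.I Complex.I = 4 * μ * W z) :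
    HasCylExpansion μ W := by
  obtain ⟨ρ, hρ0, hρR, hρ⟩ : ∃ ρ, 0 < ρ ∧ ρ < R ∧ ∀ r ∈ Icc 0 ρ, Real.exp |μ * r ^ 2| ≤ 3 / 2 := by
    have hc : Tendsto (fun r : ℝ => Real.exp |μ * r ^ 2|) (𝓝 0) (𝓝 (Real.exp |μ * 0 ^ 2|)) :=
      (by fun_prop : Continuous fun r : ℝ => Real.exp |μ * r ^ 2|).tendsto 0
    have hc' := hc.eventually_lt_const (show Real.exp |μ * 0 ^ 2| < 3 / 2 by norm_num)
    obtain ⟨ε, hε, hball⟩ := Metric.eventually_nhds_iff.1 hc'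
    refine ⟨min (ε / 2) (R / 2), by positivity, (min_le_right _ _).trans_lt (by linarith), ?_⟩
    intro r hr
    refine (hball ?_).le
    rw [Real.dist_0_eq_abs, abs_of_nonneg hr.1]
    exact (hr.2.trans (min_le_left _ _)).trans_lt (by linarith)
  have hcirc : ∀ r ∈ Ico 0 ρ, Continuous fun c : Circle => W (r * (c : ℂ)) := by
    intro r hr
    refine hW.continuousOn.comp_continuous (by fun_prop) fun c => ?_
    rw [mem_ball_zero_iff, norm_mul, Circle.norm_coe, mul_one, Complex.norm_real,
      Real.norm_of_nonneg hr.1]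
    exact hr.2.trans hρR
  obtain ⟨M, hM⟩ := (isCompact_closedBall (0 : ℂ) (ρ / 2)).exists_bound_of_continuousOn
    (hW.continuousOn.mono (Metric.closedBall_subset_ball (by linarith)))
  have hM0 : 0 ≤ M := (norm_nonneg _).trans (hM 0 (Metric.mem_closedBall_self (by linarith)))
  set c : ℕ → ℂ := fun n => circleCoeff W n (ρ / 2) / radial μ n (ρ / 2) / (2 * Real.pi) with hc
  have hcadm : CylAdmissible c := by
    -- As |W| ≤ M on the circle of radius ρ/2, `radial_ge` gives ‖c n‖ ≤ 2M (2/ρ)^n n!; the constant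
    -- dominates 1, 2M and 2/ρ.
    refine ⟨1 + 2 * M + 2 / ρ, by have : 0 ≤ 2 / ρ := by positivity
                                  linarith, fun n => ?_⟩
    have h1 : ‖circleCoeff W n (ρ / 2)‖ ≤ M * |2 * Real.pi - 0| := by
      refine intervalIntegral.norm_integral_le_of_norm_le_const fun θ _ => ?_
      rw [norm_mul, norm_angFactor, mul_one, Complex.norm_real]
      refine hM _ ?_
      rw [mem_closedBall_zero_iff, norm_ofReal_mul_unitAt, abs_of_pos (by linarith)]
    rw [sub_zero, abs_of_pos Real.two_pi_pos] at h1
    have h2 := radial_ge (μ := μ) (r := ρ / 2) (by linarith) (hρ _ ⟨by linarith, by linarith⟩) n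
    have h3 : 0 < (ρ / 2) ^ n / (2 * n.factorial) := by positivity
    have h4 : ‖c n‖ ≤ M / ((ρ / 2) ^ n / (2 * n.factorial)) := by
      rw [hc]
      simp only [norm_div, Complex.norm_real, norm_mul, Complex.norm_ofNat, Real.norm_eq_abs]
      rw [abs_of_pos Real.pi_pos, abs_of_pos (h3.trans_le h2), div_div, mul_comm, ← div_div]
      refine div_le_div₀ hM0 ?_ h3 h2
      rw [div_le_iff₀ Real.two_pi_pos]
      exact h1
    refine h4.trans ?_
    have h5 : M / ((ρ / 2) ^ n / (2 * n.factorial)) = (2 * M) * (2 / ρ) ^ n * n.factorial := by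
      rw [← inv_div ρ 2, inv_pow]
      field_simp
    rw [h5, pow_succ']
    have : 0 ≤ 2 / ρ := by positivity
    gcongr <;> linarith
  have hcoeff : ∀ r (hr : r ∈ Ico 0 ρ) (n : ℕ),
      fourierCoeff (onCircle W r (hcirc r hr)) n = c n * radial μ n r := by
    intro r hr n
    rw [fourierCoeff_onCircle, circleCoeff_eq hW hΔ n hρ0 hρR hρ hr]
    ring
  -- `W` is real, so the Fourier terms of index n and −n are conjugate and add up to twice a real
  -- part; index 0 occurs once.
  refine ⟨fun n => if n = 0 then c 0 else 2 * c n, hcadm.of_norm_le (C := 2) fun n => ?_, ?_⟩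
  · by_cases hn : n = 0
    · simp only [hn, if_true]; linarith [norm_nonneg (c 0)]
    · simp [hn]
  obtain ⟨ε, hε, hsum⟩ := Metric.eventually_nhds_iff.1 (hcadm.eventually_summable μ)
  filter_upwards [Metric.ball_mem_nhds (0 : ℂ) hε, Metric.ball_mem_nhds (0 : ℂ) hρ0] with z hzε hzρ
  rw [mem_ball_zero_iff] at hzε hzρ
  set r := ‖z‖ with hr
  set θ := Complex.arg z with hθ
  have hz : z = r * unitAt θ := (Complex.norm_mul_exp_arg_mul_I z).symm
  have hrmem : r ∈ Ico 0 ρ := ⟨norm_nonneg z, hzρ⟩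
  set f := onCircle W r (hcirc r hrmem) with hf
  have hS1 : Summable fun n : ℕ => c n * (radial μ n r : ℂ) := by
    have := hsum (y := (r : ℂ)) (by simpa [r] using hzε)
    refine this.congr fun n => ?_
    have := cyl_polar μ n r 0
    simp only [unitAt, Complex.ofReal_zero, zero_mul, Complex.exp_zero, mul_one, one_pow] at this
    rw [this]
  have hS : Summable (fourierCoeff f) := by
    refine Summable.of_nat_of_neg (hS1.congr fun n => (hcoeff r hrmem n).symm) ?_
    refine (Complex.conjCLE.summable.2 hS1).congr fun n => ?_
    rw [hf, fourierCoeff_onCircle_neg, hcoeff r hrmem]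
    rfl
  have hH := (has_pointwise_sum_fourier_series_of_summable hS (θ : AddCircle (2 * Real.pi))).nat_add_neg
  have hH' := Complex.reCLM.hasSum hH
  have hfz : f (θ : AddCircle (2 * Real.pi)) = (W z : ℂ) := by
    simp only [hf, onCircle, ContinuousMap.coe_mk, toCircle_two_pi]
    rw [← hz]
  have hterm : ∀ n : ℕ, Complex.reCLM (fourierCoeff f n • fourier (n : ℤ) (θ : AddCircle (2 * Real.pi))
      + fourierCoeff f (-n) • fourier (-n : ℤ) (θ : AddCircle (2 * Real.pi)))
      = 2 * (c n * cyl μ n z).re := by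
    intro n
    have e1 : fourierCoeff f n • fourier (n : ℤ) (θ : AddCircle (2 * Real.pi)) = c n * cyl μ n z := by
      rw [hcoeff r hrmem, fourier_two_pi, hz, cyl_polar, smul_eq_mul]
      ring
    have e2 : fourierCoeff f (-n) • fourier (-n : ℤ) (θ : AddCircle (2 * Real.pi))
        = starRingEnd ℂ (c n * cyl μ n z) := by
      rw [← e1, fourier_neg, hf, fourierCoeff_onCircle_neg, smul_eq_mul, smul_eq_mul, map_mul]
    rw [e1, e2, Complex.add_conj]
    simp
  have h00 : Complex.reCLM (fourierCoeff f 0 • fourier (0 : ℤ) (θ : AddCircle (2 * Real.pi)))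
      = (c 0 * cyl μ 0 z).re := by
    have := hterm 0
    simp only [Nat.cast_zero, neg_zero, map_add] at this
    linarith
  rw [map_add, hfz, h00] at hH'
  simp only [hterm] at hH'
  -- Pairing n with −n has counted index 0 twice; one copy is removed.
  have hfin := hH'.sub (hasSum_ite_eq (0 : ℕ) (c 0 * cyl μ 0 z).re)
  have hWz : Complex.reCLM (W z : ℂ) = W z := Complex.ofReal_re _
  rw [hWz, add_sub_cancel_right] at hfin
  rw [← hfin.tsum_eq, cylSum]
  refine tsum_congr fun n => ?_
  by_cases hn : n = 0
  · subst hn; simp; ring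
  · simp [hn]; ring

end Expansion

/-! ### Zero set of a function with harmonic leading term -/

/-- An implicit function theorem by monotonicity. If c ≠ Φ r, then G r c has a strict sign, which
persists for nearby radii and keeps their zeros on the same side of c. -/
lemma exists_continuousOn_zero {G : ℝ → ℝ → ℝ} {r₀ a b : ℝ} (hab : a ≤ b)
    (hcont : ContinuousOn (fun p : ℝ × ℝ => G p.1 p.2) (Ioc 0 r₀ ×ˢ Icc a b))
    (hmono : ∀ r ∈ Ioc 0 r₀, StrictMonoOn (G r) (Icc a b))
    (ha : ∀ r ∈ Ioc 0 r₀, G r a < 0) (hb : ∀ r ∈ Ioc 0 r₀, 0 < G r b) :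
    ∃ Φ : ℝ → ℝ, ContinuousOn Φ (Ioc 0 r₀) ∧
      ∀ r ∈ Ioc 0 r₀, Φ r ∈ Icc a b ∧ G r (Φ r) = 0 := by
  have hex : ∀ r, ∃ x, r ∈ Ioc 0 r₀ → x ∈ Icc a b ∧ G r x = 0 := by
    intro r
    by_cases hr : r ∈ Ioc 0 r₀
    · have hc : ContinuousOn (G r) (Icc a b) :=
        hcont.comp (f := fun x : ℝ => (r, x)) (by fun_prop) fun x hx => ⟨hr, hx⟩
      obtain ⟨x, hx, hx0⟩ := intermediate_value_Icc hab hc ⟨(ha r hr).le, (hb r hr).le⟩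
      exact ⟨x, fun _ => ⟨hx, hx0⟩⟩
    · exact ⟨0, fun h => absurd h hr⟩
  choose Φ hΦ using hex
  refine ⟨Φ, fun r hr => ?_, fun r hr => hΦ r hr⟩
  have hslice : ∀ c ∈ Icc a b, ContinuousWithinAt (fun r => G r c) (Ioc 0 r₀) r := fun c hc =>
    (hcont.comp (f := fun x : ℝ => (x, c)) (by fun_prop) fun x hx => ⟨hx, hc⟩) r hr
  refine tendsto_order.2 ⟨fun c hc => ?_, fun c hc => ?_⟩
  · rcases lt_or_ge c a with hca | hca
    · filter_upwards [self_mem_nhdsWithin] with x hx using hca.trans_le (hΦ x hx).1.1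
    · have hcm : c ∈ Icc a b := ⟨hca, hc.le.trans (hΦ r hr).1.2⟩
      have hneg : G r c < 0 := (hΦ r hr).2 ▸ hmono r hr hcm (hΦ r hr).1 hc
      filter_upwards [self_mem_nhdsWithin, (hslice c hcm).eventually_lt_const hneg] with x hx hxc
      by_contra! hle
      have := (hmono x hx).monotoneOn (hΦ x hx).1 hcm hle
      rw [(hΦ x hx).2] at this
      linarith
  · rcases lt_or_ge b c with hbc | hbc
    · filter_upwards [self_mem_nhdsWithin] with x hx using (hΦ x hx).1.2.trans_lt hbc
    · have hcm : c ∈ Icc a b := ⟨(hΦ r hr).1.1.trans hc.le, hbc⟩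
      have hpos : 0 < G r c := (hΦ r hr).2 ▸ hmono r hr (hΦ r hr).1 hcm hc
      filter_upwards [self_mem_nhdsWithin, (hslice c hcm).eventually_const_lt hpos] with x hx hxc
      by_contra! hle
      have := (hmono x hx).monotoneOn hcm (hΦ x hx).1 hle
      rw [(hΦ x hx).2] at this
      linarith

lemma unitAt_pow (θ : ℝ) (n : ℕ) : unitAt θ ^ n = unitAt (n * θ) := by
  rw [unitAt, unitAt, ← Complex.exp_nat_mul]
  congr 1; push_cast; ring

lemma unitAt_mul (θ φ : ℝ) : unitAt θ * unitAt φ = unitAt (θ + φ) := by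
  rw [unitAt, unitAt, unitAt, ← Complex.exp_add]
  congr 1; push_cast; ring

lemma re_unitAt (θ : ℝ) : (unitAt θ).re = Real.cos θ := Complex.exp_ofReal_mul_I_re θ

lemma im_unitAt (θ : ℝ) : (unitAt θ).im = Real.sin θ := Complex.exp_ofReal_mul_I_im θ

lemma unitAt_eq_iff {θ φ : ℝ} : unitAt θ = unitAt φ ↔ ∃ l : ℤ, θ = φ + l * (2 * Real.pi) := by
  rw [unitAt, unitAt, Complex.exp_eq_exp_iff_exists_int]
  refine exists_congr fun l => ?_
  have h : (φ : ℂ) * Complex.I + l * (2 * Real.pi * Complex.I)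
      = ((φ + l * (2 * Real.pi) : ℝ) : ℂ) * Complex.I := by push_cast; ring
  rw [h, mul_left_inj' Complex.I_ne_zero, Complex.ofReal_inj]

namespace HasHarmonicLeadingTerm

variable {g : ℂ → ℝ} {m : ℕ} {A : ℂ}

lemma exists_fderiv_bound (h : HasHarmonicLeadingTerm g m A) : ∃ C : ℝ, ∀ᶠ z in 𝓝 (0 : ℂ), ∀ v,
    |fderiv ℝ g z v - ((m + 1) * A * z ^ m * v).re| ≤ C * ‖z‖ ^ (m + 1) * ‖v‖ := by
  obtain ⟨C₁, h₁⟩ := (h.isBigO_fderiv 1).bound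
  obtain ⟨C₂, h₂⟩ := (h.isBigO_fderiv Complex.I).bound
  refine ⟨C₁ + C₂, ?_⟩
  filter_upwards [h₁, h₂] with z hz₁ hz₂ v
  simp only [Real.norm_eq_abs, abs_pow, abs_norm, mul_one] at hz₁ hz₂
  set P : ℂ := (m + 1) * A * z ^ m
  have hv : v = v.re • (1 : ℂ) + v.im • Complex.I := by simp
  have hf : fderiv ℝ g z v = v.re * fderiv ℝ g z 1 + v.im * fderiv ℝ g z Complex.I := by
    conv_lhs => rw [hv, map_add, map_smul, map_smul, smul_eq_mul, smul_eq_mul]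
  have hp : (P * v).re = v.re * P.re + v.im * (P * Complex.I).re := by
    simp [Complex.mul_re]; ring
  rw [hf, hp, show v.re * fderiv ℝ g z 1 + v.im * fderiv ℝ g z Complex.I -
    (v.re * P.re + v.im * (P * Complex.I).re) = v.re * (fderiv ℝ g z 1 - P.re) +
      v.im * (fderiv ℝ g z Complex.I - (P * Complex.I).re) by ring]
  refine (abs_add_le _ _).trans ?_
  rw [abs_mul, abs_mul]
  calc _ ≤ ‖v‖ * (C₁ * ‖z‖ ^ (m + 1)) + ‖v‖ * (C₂ * ‖z‖ ^ (m + 1)) := by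
        gcongr
        · exact Complex.abs_re_le_norm v
        · exact Complex.abs_im_le_norm v
    _ = _ := by ring

lemma apply_zero (h : HasHarmonicLeadingTerm g m A) : g 0 = 0 := by
  obtain ⟨C, hC⟩ := h.isBigO.bound
  simpa using hC.self_of_nhds

/-- The extra power of |z| in the errors is traded for the factor 1/2, which lies below √2/2 =
sin(π/4), the threshold in the sector arguments below. -/
lemma exists_estimates (h : HasHarmonicLeadingTerm g m A) {S : Set ℂ} (hS : S ∈ 𝓝 (0 : ℂ)) :
    ∃ r₀ > 0, Metric.closedBall 0 r₀ ⊆ S ∧ ∀ z ∈ Metric.closedBall (0 : ℂ) r₀,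
      DifferentiableAt ℝ g z ∧
      (z ≠ 0 → |g z - (A * z ^ (m + 1)).re| < ‖A‖ / 2 * ‖z‖ ^ (m + 1)) ∧
      (∀ v, z ≠ 0 → v ≠ 0 →
        |fderiv ℝ g z v - ((m + 1) * A * z ^ m * v).re| < ‖A‖ / 2 * ‖z‖ ^ m * ‖v‖) := by
  obtain ⟨C₁, h₁⟩ := h.isBigO.bound
  obtain ⟨C₂, h₂⟩ := h.exists_fderiv_bound
  have hA : 0 < ‖A‖ / 2 := by have := norm_pos_iff.2 h.ne_zero; positivity
  have hsmall : ∀ C : ℝ, ∀ᶠ z in 𝓝 (0 : ℂ), C * ‖z‖ < ‖A‖ / 2 := fun C => by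
    have : Tendsto (fun z : ℂ => C * ‖z‖) (𝓝 0) (𝓝 (C * ‖(0 : ℂ)‖)) :=
      (continuous_norm.const_mul C).tendsto 0
    exact this.eventually_lt_const (by simpa using hA)
  have hall : ∀ᶠ z in 𝓝 (0 : ℂ), z ∈ S ∧ DifferentiableAt ℝ g z ∧
      (z ≠ 0 → |g z - (A * z ^ (m + 1)).re| < ‖A‖ / 2 * ‖z‖ ^ (m + 1)) ∧
      (∀ v, z ≠ 0 → v ≠ 0 →
        |fderiv ℝ g z v - ((m + 1) * A * z ^ m * v).re| < ‖A‖ / 2 * ‖z‖ ^ m * ‖v‖) := by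
    filter_upwards [hS, h.differentiable, h₁, h₂, hsmall C₁, hsmall C₂] with z a0 a1 a2 a3 a4 a5
    refine ⟨a0, a1, fun hz => ?_, fun v hz hv => ?_⟩
    · rw [Real.norm_eq_abs, norm_pow, norm_norm] at a2
      have := norm_pos_iff.2 hz
      calc _ ≤ C₁ * ‖z‖ ^ (m + 2) := a2
        _ = C₁ * ‖z‖ * ‖z‖ ^ (m + 1) := by ring
        _ < _ := by gcongr
    · have := norm_pos_iff.2 hz
      have := norm_pos_iff.2 hv
      calc _ ≤ C₂ * ‖z‖ ^ (m + 1) * ‖v‖ := a3 v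
        _ = C₂ * ‖z‖ * ‖z‖ ^ m * ‖v‖ := by ring
        _ < _ := by gcongr
  obtain ⟨r₀, hr₀, hsub⟩ := Metric.nhds_basis_closedBall.mem_iff.1 hall
  exact ⟨r₀, hr₀, fun z hz => (hsub hz).1, fun z hz => (hsub hz).2⟩

/-- The `k`-th zero of the angular part of `Re (A z ^ (m + 1))`. -/
noncomputable def zeroAngle (m : ℕ) (A : ℂ) (k : ℕ) : ℝ :=
  (Real.pi / 2 - A.arg + k * Real.pi) / (m + 1)

lemma re_leading_polar (A : ℂ) (m : ℕ) (r θ : ℝ) :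
    (A * ((r : ℂ) * unitAt θ) ^ (m + 1)).re
      = ‖A‖ * r ^ (m + 1) * Real.cos ((m + 1) * θ + A.arg) := by
  have hA : A = ‖A‖ * unitAt A.arg := (Complex.norm_mul_exp_arg_mul_I A).symm
  have : A * ((r : ℂ) * unitAt θ) ^ (m + 1)
      = ((‖A‖ * r ^ (m + 1) : ℝ) : ℂ) * unitAt ((m + 1) * θ + A.arg) := by
    rw [mul_pow, unitAt_pow]
    conv_lhs => rw [hA]
    rw [← unitAt_mul, Nat.cast_succ]
    push_cast
    ring
  rw [this, Complex.re_ofReal_mul, re_unitAt]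

lemma re_leading_deriv_polar (A : ℂ) (m : ℕ) (r θ : ℝ) :
    ((m + 1) * A * ((r : ℂ) * unitAt θ) ^ m * (r * (Complex.I * unitAt θ))).re
      = -((m + 1) * ‖A‖ * r ^ (m + 1) * Real.sin ((m + 1) * θ + A.arg)) := by
  have hA : A = ‖A‖ * unitAt A.arg := (Complex.norm_mul_exp_arg_mul_I A).symm
  have : (m + 1) * A * ((r : ℂ) * unitAt θ) ^ m * (r * (Complex.I * unitAt θ))
      = (((m + 1) * ‖A‖ * r ^ (m + 1) : ℝ) : ℂ) *
        (Complex.I * unitAt ((m + 1) * θ + A.arg)) := by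
    have e : unitAt ((m + 1) * θ + A.arg) = unitAt θ ^ m * unitAt θ * unitAt A.arg := by
      rw [unitAt_pow, unitAt_mul, unitAt_mul]; congr 1; ring
    rw [e, mul_pow]
    conv_lhs => rw [hA]
    push_cast
    ring
  rw [this, Complex.re_ofReal_mul, Complex.I_mul_re, im_unitAt]
  ring

lemma angle_eq (m : ℕ) (A : ℂ) (k : ℕ) (φ : ℝ) :
    (m + 1) * (zeroAngle m A k + φ) + A.arg = (m + 1) * φ + Real.pi / 2 + k * Real.pi := by
  have : (m : ℝ) + 1 ≠ 0 := by positivity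
  rw [zeroAngle]; field_simp; ring

lemma sqrt_two_div_two_gt : 1 / 2 < √2 / 2 := by
  have : 1 < √2 := by rw [Real.lt_sqrt] <;> norm_num
  linarith

/-- In the sector (m+1)|φ| ≤ π/4 about a zero angle, ±g is ‖A‖ r^(m+1) sin((m+1)φ) up to an error
below half of ‖A‖ r^(m+1). On the two edges |sin| is √2/2, which fixes the signs; inside, cos ≥ √2/2
makes the angular derivative positive. -/
lemma exists_zero_branch (h : HasHarmonicLeadingTerm g m A) {r₀ : ℝ}
    (hest : ∀ z ∈ Metric.closedBall (0 : ℂ) r₀, DifferentiableAt ℝ g z ∧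
      (z ≠ 0 → |g z - (A * z ^ (m + 1)).re| < ‖A‖ / 2 * ‖z‖ ^ (m + 1)) ∧
      (∀ v, z ≠ 0 → v ≠ 0 →
        |fderiv ℝ g z v - ((m + 1) * A * z ^ m * v).re| < ‖A‖ / 2 * ‖z‖ ^ m * ‖v‖)) (k : ℕ) :
    ∃ Φ : ℝ → ℝ, ContinuousOn Φ (Ioc 0 r₀) ∧ ∀ r ∈ Ioc 0 r₀,
      (m + 1) * |Φ r| ≤ Real.pi / 4 ∧ g (r * unitAt (zeroAngle m A k + Φ r)) = 0 ∧
      ∀ φ : ℝ, (m + 1) * |φ| ≤ Real.pi / 4 → g (r * unitAt (zeroAngle m A k + φ)) = 0 →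
        φ = Φ r := by
  have hm : (0 : ℝ) < m + 1 := by positivity
  have hA := norm_pos_iff.2 h.ne_zero
  set δ : ℝ := Real.pi / 4 / (m + 1) with hδ
  have hδ0 : 0 < δ := by have := Real.pi_pos; positivity
  have hmδ : (m + 1) * δ = Real.pi / 4 := by rw [hδ]; field_simp
  have hIcc : ∀ φ : ℝ, φ ∈ Icc (-δ) δ ↔ (m + 1) * |φ| ≤ Real.pi / 4 := fun φ => by
    rw [← hmδ, mul_le_mul_iff_right₀ hm, abs_le, mem_Icc]
  -- The leading term crosses zero alternately upwards and downwards; this sign makes every crossing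
  -- increasing.
  set σ : ℝ := -(-1) ^ k with hσ
  have hσ2 : σ * σ = 1 := by rw [hσ, neg_mul_neg, ← mul_pow]; simp
  have hσ1 : |σ| = 1 := by rw [hσ, abs_neg, abs_pow]; simp
  have hσ0 : σ ≠ 0 := fun h0 => by simp [h0] at hσ2
  have hmem : ∀ r ∈ Ioc 0 r₀, ∀ θ : ℝ, (r : ℂ) * unitAt θ ∈ Metric.closedBall (0 : ℂ) r₀ ∧
      (r : ℂ) * unitAt θ ≠ 0 ∧ ‖(r : ℂ) * unitAt θ‖ = r := fun r hr θ => by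
    have hn : ‖(r : ℂ) * unitAt θ‖ = r := by rw [norm_ofReal_mul_unitAt, abs_of_pos hr.1]
    refine ⟨by rw [mem_closedBall_zero_iff, hn]; exact hr.2, ?_, hn⟩
    rw [← norm_pos_iff, hn]; exact hr.1
  set G : ℝ → ℝ → ℝ := fun r φ => σ * g (r * unitAt (zeroAngle m A k + φ)) with hG
  have hcos : ∀ φ : ℝ, σ * Real.cos ((m + 1) * (zeroAngle m A k + φ) + A.arg)
      = Real.sin ((m + 1) * φ) := fun φ => by
    rw [angle_eq, Real.cos_add_nat_mul_pi, Real.cos_add_pi_div_two]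
    linear_combination (Real.sin ((m + 1) * φ)) * hσ2 - Real.sin ((m + 1) * φ) * σ * hσ
  have hsin : ∀ φ : ℝ, σ * Real.sin ((m + 1) * (zeroAngle m A k + φ) + A.arg)
      = -Real.cos ((m + 1) * φ) := fun φ => by
    rw [angle_eq, Real.sin_add_nat_mul_pi, Real.sin_add_pi_div_two]
    linear_combination -(Real.cos ((m + 1) * φ)) * hσ2 + Real.cos ((m + 1) * φ) * σ * hσ
  have hGval : ∀ r ∈ Ioc 0 r₀, ∀ φ : ℝ,
      |G r φ - ‖A‖ * r ^ (m + 1) * Real.sin ((m + 1) * φ)| < ‖A‖ / 2 * r ^ (m + 1) := by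
    intro r hr φ
    obtain ⟨h1, h2, h3⟩ := hmem r hr (zeroAngle m A k + φ)
    have := (hest _ h1).2.1 h2
    rw [re_leading_polar, h3] at this
    rw [← hcos, hG, show σ * g (r * unitAt (zeroAngle m A k + φ)) - ‖A‖ * r ^ (m + 1) *
      (σ * Real.cos ((m + 1) * (zeroAngle m A k + φ) + A.arg)) =
      σ * (g (r * unitAt (zeroAngle m A k + φ)) - ‖A‖ * r ^ (m + 1) *
      (Real.cos ((m + 1) * (zeroAngle m A k + φ) + A.arg))) by ring, abs_mul, hσ1, one_mul]
    exact this
  have hGder : ∀ r ∈ Ioc 0 r₀, ∀ φ : ℝ, ∃ d, HasDerivAt (G r) d φ ∧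
      |d - (m + 1) * ‖A‖ * r ^ (m + 1) * Real.cos ((m + 1) * φ)| < ‖A‖ / 2 * r ^ (m + 1) := by
    intro r hr φ
    obtain ⟨h1, h2, h3⟩ := hmem r hr (zeroAngle m A k + φ)
    obtain ⟨hd, -, hv⟩ := hest _ h1
    have hI : ‖(r : ℂ) * (Complex.I * unitAt (zeroAngle m A k + φ))‖ = r := by
      rw [mul_left_comm, norm_mul, Complex.norm_I, one_mul, h3]
    have hI0 : (r : ℂ) * (Complex.I * unitAt (zeroAngle m A k + φ)) ≠ 0 := by
      rw [← norm_pos_iff, hI]; exact hr.1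
    refine ⟨_, ((hasDerivAt_angular hd).comp_const_add (zeroAngle m A k) φ).const_mul σ, ?_⟩
    have := hv _ h2 hI0
    rw [re_leading_deriv_polar, h3, hI, mul_assoc (‖A‖ / 2), ← pow_succ, sub_neg_eq_add] at this
    have e := hsin φ
    rw [show σ * fderiv ℝ g (r * unitAt (zeroAngle m A k + φ))
        (r * (Complex.I * unitAt (zeroAngle m A k + φ))) -
        (m + 1) * ‖A‖ * r ^ (m + 1) * Real.cos ((m + 1) * φ) =
      σ * (fderiv ℝ g (r * unitAt (zeroAngle m A k + φ))
        (r * (Complex.I * unitAt (zeroAngle m A k + φ))) + (m + 1) * ‖A‖ * r ^ (m + 1) *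
      Real.sin ((m + 1) * (zeroAngle m A k + φ) + A.arg)) by
        linear_combination -(m + 1) * ‖A‖ * r ^ (m + 1) * e, abs_mul, hσ1, one_mul]
    exact this
  have hcos_ge : ∀ φ ∈ Icc (-δ) δ, √2 / 2 ≤ Real.cos ((m + 1) * φ) := by
    intro φ hφ
    have h1 := (hIcc φ).1 hφ
    rw [← Real.cos_pi_div_four, ← Real.cos_abs ((m + 1) * φ), abs_mul, abs_of_pos hm]
    exact Real.cos_le_cos_of_nonneg_of_le_pi (by positivity) (by linarith [Real.pi_pos]) h1
  have hmono : ∀ r ∈ Ioc 0 r₀, StrictMonoOn (G r) (Icc (-δ) δ) := by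
    intro r hr
    have hrp : 0 < r ^ (m + 1) := pow_pos hr.1 _
    refine strictMonoOn_of_deriv_pos (convex_Icc _ _) (fun φ _ => ?_) fun φ hφ => ?_
    · obtain ⟨d, hd, -⟩ := hGder r hr φ
      exact hd.continuousAt.continuousWithinAt
    · obtain ⟨d, hd, hd'⟩ := hGder r hr φ
      rw [hd.deriv]
      have h1 := hcos_ge φ (interior_subset hφ)
      have h2 := (abs_lt.1 hd').1
      have h3 : ‖A‖ * r ^ (m + 1) * (1 / 2) ≤
          (m + 1) * (‖A‖ * r ^ (m + 1)) * Real.cos ((m + 1) * φ) := by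
        have : (1 : ℝ) ≤ m + 1 := by simp
        have h4 := sqrt_two_div_two_gt
        have h5 : 0 < ‖A‖ * r ^ (m + 1) := by positivity
        refine mul_le_mul (by nlinarith) (by linarith) (by norm_num) (by positivity)
      linarith
  have hsinδ : Real.sin ((m + 1) * δ) = √2 / 2 := by rw [hmδ, Real.sin_pi_div_four]
  have hcont : ContinuousOn (fun p : ℝ × ℝ => G p.1 p.2) (Ioc 0 r₀ ×ˢ Icc (-δ) δ) := by
    have hg : ContinuousOn g (Metric.closedBall 0 r₀) := fun z hz =>
      (hest z hz).1.continuousAt.continuousWithinAt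
    refine continuousOn_const.mul (hg.comp (by fun_prop) fun p hp => (hmem p.1 hp.1 _).1)
  have hneg : ∀ r ∈ Ioc 0 r₀, G r (-δ) < 0 := by
    intro r hr
    have h1 := (abs_lt.1 (hGval r hr (-δ))).2
    rw [mul_neg, Real.sin_neg, hsinδ] at h1
    have : 0 < ‖A‖ * r ^ (m + 1) := mul_pos hA (pow_pos hr.1 _)
    nlinarith [sqrt_two_div_two_gt]
  have hpos : ∀ r ∈ Ioc 0 r₀, 0 < G r δ := by
    intro r hr
    have h1 := (abs_lt.1 (hGval r hr δ)).1
    rw [hsinδ] at h1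
    have : 0 < ‖A‖ * r ^ (m + 1) := mul_pos hA (pow_pos hr.1 _)
    nlinarith [sqrt_two_div_two_gt]
  obtain ⟨Φ, hΦc, hΦ⟩ := exists_continuousOn_zero (by linarith) hcont hmono hneg hpos
  refine ⟨Φ, hΦc, fun r hr => ⟨(hIcc _).1 (hΦ r hr).1, ?_, fun φ hφ hφ0 => ?_⟩⟩
  · exact (mul_eq_zero.1 (hΦ r hr).2).resolve_left hσ0
  · refine (hmono r hr).injOn ((hIcc φ).2 hφ) (hΦ r hr).1 ?_
    rw [(hΦ r hr).2, hG]
    simp [hφ0]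

/-- Outside the sectors the leading term is at least √2/2 · ‖A‖ |z|^(m+1) in absolute value, which
the error cannot cancel. -/
lemma exists_angle_of_zero (h : HasHarmonicLeadingTerm g m A) {z : ℂ} (hz : z ≠ 0) (hgz : g z = 0)
    (hest : |g z - (A * z ^ (m + 1)).re| < ‖A‖ / 2 * ‖z‖ ^ (m + 1)) :
    ∃ k < 2 * (m + 1), ∃ φ : ℝ, (m + 1) * |φ| ≤ Real.pi / 4 ∧
      z = ‖z‖ * unitAt (zeroAngle m A k + φ) := by
  have hm : (0 : ℝ) < m + 1 := by positivity
  have hπ := Real.pi_pos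
  have hA := norm_pos_iff.2 h.ne_zero
  have hzp := norm_pos_iff.2 hz
  set θ := z.arg with hθ
  have hzθ : z = ‖z‖ * unitAt θ := (Complex.norm_mul_exp_arg_mul_I z).symm
  set x : ℝ := (m + 1) * θ + A.arg - Real.pi / 2 with hx
  set k : ℤ := round (x / Real.pi) with hk
  set ψ : ℝ := x - k * Real.pi with hψ
  have hψ2 : |ψ| ≤ Real.pi / 2 := by
    have h1 := abs_sub_round (x / Real.pi)
    have h2 : ψ = (x / Real.pi - k) * Real.pi := by rw [hψ]; field_simp
    rw [h2, abs_mul, abs_of_pos hπ]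
    nlinarith
  have hcos : |Real.cos ((m + 1) * θ + A.arg)| = Real.sin |ψ| := by
    rw [show (m + 1) * θ + A.arg = ψ + Real.pi / 2 + k * Real.pi by rw [hψ, hx]; ring,
      Real.cos_add_int_mul_pi, abs_mul, Real.cos_add_pi_div_two, abs_neg, abs_zpow]
    simp only [abs_neg, abs_one, one_zpow, one_mul]
    rcases abs_cases ψ with ⟨e, h0⟩ | ⟨e, h0⟩ <;> rw [e]
    · exact abs_of_nonneg (Real.sin_nonneg_of_nonneg_of_le_pi h0 (by rw [e] at hψ2; linarith))
    · rw [← abs_neg, ← Real.sin_neg]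
      exact abs_of_nonneg (Real.sin_nonneg_of_nonneg_of_le_pi (by linarith)
        (by rw [e] at hψ2; linarith))
  have hψ4 : |ψ| ≤ Real.pi / 4 := by
    by_contra! hlt
    have h1 : Real.sin (Real.pi / 4) ≤ Real.sin |ψ| :=
      Real.sin_le_sin_of_le_of_le_pi_div_two (by linarith) hψ2 hlt.le
    rw [Real.sin_pi_div_four] at h1
    have hre := re_leading_polar A m ‖z‖ θ
    rw [← hzθ] at hre
    rw [hgz, hre, zero_sub, abs_neg, abs_mul, abs_of_pos (by positivity), hcos] at hest
    have : 0 < ‖A‖ * ‖z‖ ^ (m + 1) := by positivity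
    nlinarith [sqrt_two_div_two_gt]
  have h2m : (0 : ℤ) < 2 * (m + 1) := by positivity
  -- Raising the index by 2(m+1) turns the zero angle by 2π, so only the residue of the nearest
  -- index matters.
  refine ⟨(k % (2 * (m + 1))).toNat, ?_, ψ / (m + 1), ?_, ?_⟩
  · have := Int.emod_lt_of_pos k h2m
    have := Int.emod_nonneg k h2m.ne'
    omega
  · rw [abs_div, abs_of_pos hm]
    rwa [mul_div_cancel₀ _ hm.ne']
  · conv_lhs => rw [hzθ]
    congr 1
    rw [unitAt_eq_iff]
    refine ⟨k / (2 * (m + 1)), ?_⟩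
    have h1 : (((k % (2 * (m + 1))).toNat : ℕ) : ℝ) = ((k % (2 * (m + 1)) : ℤ) : ℝ) := by
      exact_mod_cast congrArg (Int.cast : ℤ → ℝ) (Int.toNat_of_nonneg (Int.emod_nonneg k h2m.ne'))
    have h2 : (k : ℝ) = (2 * (m + 1)) * ((k / (2 * (m + 1)) : ℤ) : ℝ)
        + ((k % (2 * (m + 1)) : ℤ) : ℝ) := by
      exact_mod_cast (Int.mul_ediv_add_emod k (2 * (m + 1))).symm
    rw [zeroAngle, h1]
    field_simp
    rw [hψ, hx]
    linear_combination 2 * Real.pi * h2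

/-- Zero angles are π/(m+1) apart and each sector has half-width π/(4(m+1)), so distinct sectors are
disjoint. -/
lemma index_eq_of_unitAt_eq {i j : ℕ} (hi : i < 2 * (m + 1)) (hj : j < 2 * (m + 1)) {φ φ' : ℝ}
    (hφ : (m + 1) * |φ| ≤ Real.pi / 4) (hφ' : (m + 1) * |φ'| ≤ Real.pi / 4)
    (he : unitAt (zeroAngle m A i + φ) = unitAt (zeroAngle m A j + φ')) : i = j := by
  have hm : (0 : ℝ) < m + 1 := by positivity
  have hπ := Real.pi_pos
  obtain ⟨l, hl⟩ := unitAt_eq_iff.1 he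
  have h1 : (((i : ℤ) - j - 2 * (m + 1) * l : ℤ) : ℝ) * Real.pi = (m + 1) * (φ' - φ) := by
    rw [zeroAngle, zeroAngle] at hl
    push_cast
    field_simp at hl
    linear_combination (1 / 2) * hl
  have h2 : |(((i : ℤ) - j - 2 * (m + 1) * l : ℤ) : ℝ)| * Real.pi ≤ Real.pi / 2 := by
    rw [← abs_of_pos hπ, ← abs_mul, abs_of_pos hπ, h1, abs_mul, abs_of_pos hm]
    have := abs_sub φ' φ
    nlinarith
  have h3 : |(((i : ℤ) - j - 2 * (m + 1) * l : ℤ) : ℝ)| < 1 := by nlinarith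
  have h4 : (i : ℤ) - j - 2 * (m + 1) * l = 0 := by
    rw [← Int.abs_lt_one_iff]; exact_mod_cast h3
  have h5 : l = 0 := by
    by_contra h0
    rcases lt_or_gt_of_ne h0 with h0 | h0
    · have : 2 * ((m : ℤ) + 1) * l ≤ 2 * (m + 1) * (-1) := by gcongr; omega
      omega
    · have : 2 * ((m : ℤ) + 1) * 1 ≤ 2 * (m + 1) * l := by gcongr; omega
      omega
  rw [h5] at h4
  omega

/-- The zero set of a function with harmonic leading term of degree `m + 1` consists of
`2 (m + 1)` arcs near `0`. -/
theorem exists_arcs (h : HasHarmonicLeadingTerm g m A) {S : Set ℂ} (hS : S ∈ 𝓝 (0 : ℂ)) :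
    ∃ V ∈ 𝓝 (0 : ℂ), V ⊆ S ∧ ∃ e : Fin (2 * (m + 1)) → ℝ → ℂ,
      (∀ i, ContinuousOn (e i) (Icc 0 1)) ∧ (∀ i, InjOn (e i) (Icc 0 1)) ∧ (∀ i, e i 0 = 0) ∧
      (∀ i j, i ≠ j → e i '' Icc 0 1 ∩ e j '' Icc 0 1 = {0}) ∧
      {z | g z = 0} ∩ V = {0} ∪ ⋃ i, e i '' Icc 0 1 := by
  obtain ⟨r₀, hr₀, hsub, hest⟩ := h.exists_estimates hS
  choose Φ hΦc hΦ using h.exists_zero_branch hest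
  -- Parametrization by the radius: equal points have equal parameters, which gives injectivity and
  -- reduces intersections to a comparison of angles. At s = 0 the uncontrolled value of Φ is
  -- multiplied by 0.
  set e : Fin (2 * (m + 1)) → ℝ → ℂ := fun i s =>
    (r₀ * s : ℝ) * unitAt (zeroAngle m A i + Φ i (r₀ * s)) with he
  have hscale : ∀ s ∈ Ioc (0 : ℝ) 1, r₀ * s ∈ Ioc 0 r₀ := fun s hs =>
    ⟨mul_pos hr₀ hs.1, mul_le_of_le_one_right hr₀.le hs.2⟩
  have hnorm : ∀ i, ∀ s ∈ Icc (0 : ℝ) 1, ‖e i s‖ = r₀ * s := fun i s hs => by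
    rw [he, norm_ofReal_mul_unitAt, abs_of_nonneg (mul_nonneg hr₀.le hs.1)]
  have he0 : ∀ i, e i 0 = 0 := fun i => by simp [he]
  refine ⟨_, Metric.closedBall_mem_nhds 0 hr₀, hsub, e, fun i s hs => ?_, fun i s hs s' hs' hss => ?_,
    he0, fun i j hij => ?_, ?_⟩
  · rcases hs.1.eq_or_lt with rfl | hs0
    · have hb : Tendsto (fun s : ℝ => |r₀ * s|) (𝓝[Icc 0 1] 0) (𝓝 0) := by
        have : Continuous fun s : ℝ => |r₀ * s| := by fun_prop
        simpa using (this.tendsto 0).mono_left nhdsWithin_le_nhds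
      rw [ContinuousWithinAt, he0]
      refine squeeze_zero_norm (fun s => ?_) hb
      rw [he, norm_ofReal_mul_unitAt]
    · have h1 : ContinuousOn (e i) (Ioc 0 1) := by
        have h2 : ContinuousOn (fun s => Φ i (r₀ * s)) (Ioc 0 1) :=
          (hΦc i).comp (by fun_prop) hscale
        have h3 : ContinuousOn (fun s => unitAt (zeroAngle m A i + Φ i (r₀ * s))) (Ioc 0 1) :=
          continuous_unitAt.comp_continuousOn (continuousOn_const.add h2)
        exact (by fun_prop : Continuous fun s : ℝ => ((r₀ * s : ℝ) : ℂ)).continuousOn.mul h3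
      refine (h1 s ⟨hs0, hs.2⟩).mono_of_mem_nhdsWithin ?_
      filter_upwards [self_mem_nhdsWithin, nhdsWithin_le_nhds (Ioi_mem_nhds hs0)] with x hx hx0
        using ⟨hx0, hx.2⟩
  · have := congrArg norm hss
    rw [hnorm i s hs, hnorm i s' hs'] at this
    exact mul_left_cancel₀ hr₀.ne' this
  · refine Subset.antisymm ?_ ?_
    · rintro z ⟨⟨s, hs, rfl⟩, s', hs', hss⟩
      have hss' : s' = s := by
        have := congrArg norm hss
        rw [hnorm i s hs, hnorm j s' hs'] at this
        exact mul_left_cancel₀ hr₀.ne' this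
      subst hss'
      rcases hs.1.eq_or_lt with rfl | hs0
      · exact he0 i
      · exfalso
        have hr := hscale s' ⟨hs0, hs.2⟩
        have hne : ((r₀ * s' : ℝ) : ℂ) ≠ 0 := by exact_mod_cast hr.1.ne'
        exact hij (Fin.ext (index_eq_of_unitAt_eq i.2 j.2 (hΦ i _ hr).1 (hΦ j _ hr).1
          (mul_left_cancel₀ hne hss.symm)))
    · rintro z rfl
      exact ⟨⟨0, by simp, he0 i⟩, 0, by simp, he0 j⟩
  · refine Subset.antisymm ?_ ?_
    · rintro z ⟨hgz, hz⟩
      by_cases hz0 : z = 0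
      · exact .inl hz0
      refine .inr (mem_iUnion.2 ?_)
      obtain ⟨k, hk, φ, hφ, hzφ⟩ := h.exists_angle_of_zero hz0 hgz ((hest z hz).2.1 hz0)
      have hr : ‖z‖ ∈ Ioc 0 r₀ := ⟨norm_pos_iff.2 hz0, mem_closedBall_zero_iff.1 hz⟩
      have hφ' := (hΦ k ‖z‖ hr).2.2 φ hφ (by rw [← hzφ]; exact hgz)
      refine ⟨⟨k, hk⟩, ‖z‖ / r₀, ⟨by positivity, (div_le_one hr₀).2 hr.2⟩, ?_⟩
      simp only [he]
      rw [mul_div_cancel₀ _ hr₀.ne', ← hφ', ← hzφ]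
    · rintro z (rfl | hz)
      · exact ⟨h.apply_zero, Metric.mem_closedBall_self hr₀.le⟩
      · obtain ⟨i, s, hs, rfl⟩ := mem_iUnion.1 hz
        refine ⟨?_, by rw [mem_closedBall_zero_iff, hnorm i s hs]; nlinarith [hs.2]⟩
        rcases hs.1.eq_or_lt with rfl | hs0
        · rw [mem_ofPred_eq, he0]; exact h.apply_zero
        · exact (hΦ i _ (hscale s ⟨hs0, hs.2⟩)).2.1

end HasHarmonicLeadingTerm

/-! ### Transfer from ℂ to the Euclidean plane -/

/-- The standard isometry between `ℂ` and the plane. -/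
noncomputable def toPlane : ℂ ≃ₗᵢ[ℝ] Plane := Complex.orthonormalBasisOneI.repr

lemma toPlane_apply_zero (z : ℂ) : toPlane z 0 = z.re :=
  congrFun (Complex.orthonormalBasisOneI_repr_apply z) 0

lemma toPlane_apply_one (z : ℂ) : toPlane z 1 = z.im :=
  congrFun (Complex.orthonormalBasisOneI_repr_apply z) 1

lemma quarterTurn_toPlane (z : ℂ) : quarterTurn (toPlane z) = toPlane (Complex.I * z) := by
  ext i
  fin_cases i
  · simp [quarterTurn, toPlane_apply_zero, toPlane_apply_one]
  · simp [quarterTurn, toPlane_apply_zero, toPlane_apply_one]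

lemma fderiv_comp_toPlane {F : Type*} [NormedAddCommGroup F] [NormedSpace ℝ F] (f : Plane → F)
    (p : Plane) (z : ℂ) :
    fderiv ℝ (fun z => f (p + toPlane z)) z =
      (fderiv ℝ f (p + toPlane z)).comp (toPlane.toContinuousLinearEquiv : ℂ →L[ℝ] Plane) := by
  have h := toPlane.toContinuousLinearEquiv.comp_right_fderiv (f := fun x => f (p + x)) (x := z)
  rw [fderiv_comp_add_left] at h
  exact h

lemma norm_fderiv_comp_toPlane (f : Plane → ℝ) (p : Plane) (z : ℂ) :
    ‖fderiv ℝ (fun z => f (p + toPlane z)) z‖ = ‖fderiv ℝ f (p + toPlane z)‖ := by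
  rw [fderiv_comp_toPlane]
  exact ContinuousLinearMap.opNorm_comp_linearIsometryEquiv _ toPlane

lemma fderiv_fderiv_comp_toPlane {f : Plane → ℝ} {p : Plane} {z : ℂ}
    (hf : DifferentiableAt ℝ (fderiv ℝ f) (p + toPlane z)) (u v : ℂ) :
    fderiv ℝ (fderiv ℝ (fun z => f (p + toPlane z))) z u v =
      fderiv ℝ (fderiv ℝ f) (p + toPlane z) (toPlane u) (toPlane v) := by
  have h1 : fderiv ℝ (fun z => f (p + toPlane z)) = fun z =>
      (fderiv ℝ f (p + toPlane z)).comp (toPlane.toContinuousLinearEquiv : ℂ →L[ℝ] Plane) :=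
    funext fun z => fderiv_comp_toPlane f p z
  have hd : DifferentiableAt ℝ (fun z => fderiv ℝ f (p + toPlane z)) z := by
    refine DifferentiableAt.comp z hf ?_
    exact (toPlane.toContinuousLinearEquiv.differentiableAt).const_add p
  rw [h1, fderiv_clm_comp hd (differentiableAt_const _), fderiv_comp_toPlane]
  simp

lemma laplacian_eq_toPlane (w : Plane → ℝ) (x : Plane) :
    (Δ w) x = fderiv ℝ (fderiv ℝ w) x (toPlane 1) (toPlane 1) +
      fderiv ℝ (fderiv ℝ w) x (toPlane Complex.I) (toPlane Complex.I) := by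
  rw [InnerProductSpace.laplacian_eq_iteratedFDeriv_orthonormalBasis w
    (Complex.orthonormalBasisOneI.map toPlane)]
  simp [iteratedFDeriv_two_apply]

/-- Near any point of the plane, seen from there, `f` has an expansion in cylindrical solutions. -/
def HasCylExpansionAt (μ : ℝ) (f : Plane → ℝ) (p : Plane) : Prop :=
  HasCylExpansion μ fun z => f (p + toPlane z)

/-! ### Local structure of eigenfunctions and unique continuation -/

section Eigenfunction

variable {U : Set Plane} {w : Plane → ℝ} {μ : ℝ}

lemma hasCylExpansionAt_of_laplacian (hUo : IsOpen U) (hw : ContDiffOn ℝ 2 w U)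
    (hΔ : ∀ z ∈ U, (Δ w) z = 4 * μ * w z) {p : Plane} (hp : p ∈ U) :
    HasCylExpansionAt μ w p := by
  obtain ⟨R, hR, hball⟩ := Metric.isOpen_iff.1 hUo p hp
  have hmem : ∀ z ∈ Metric.ball (0 : ℂ) R, p + toPlane z ∈ U := fun z hz => hball <| by
    rw [mem_ball_zero_iff] at hz
    rw [mem_ball_iff_norm, add_sub_cancel_left, toPlane.norm_map]
    exact hz
  refine hasCylExpansion_of_laplace hR (hw.comp ?_ hmem) fun z hz => ?_
  · exact (contDiff_const.add toPlane.contDiff).contDiffOn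
  · have hd : DifferentiableAt ℝ (fderiv ℝ w) (p + toPlane z) :=
      ((hw.fderiv_of_isOpen hUo (m := 1) (by norm_num)).contDiffAt
        (hUo.mem_nhds (hmem z hz))).differentiableAt (by norm_num)
    rw [fderiv_fderiv_comp_toPlane hd, fderiv_fderiv_comp_toPlane hd, ← laplacian_eq_toPlane]
    exact hΔ _ (hmem z hz)

lemma HasCylExpansionAt.rotDeriv {p : Plane} (h : HasCylExpansionAt μ w p) (q : Plane) :
    HasCylExpansionAt μ (rotDeriv q w) p := by
  have heq : (fun z => _root_.rotDeriv q w (p + toPlane z)) = fun z =>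
      fderiv ℝ (fun z => w (p + toPlane z)) z (Complex.I * (z - toPlane.symm (q - p))) := by
    ext z
    have : p + toPlane z - q = toPlane (z - toPlane.symm (q - p)) := by
      rw [map_sub, LinearIsometryEquiv.apply_symm_apply]; abel
    rw [fderiv_comp_toPlane, _root_.rotDeriv, this, quarterTurn_toPlane]
    rfl
  rw [HasCylExpansionAt, heq]
  exact HasCylExpansion.rotation h _

/-- The gradient of Re(A z^(m+1)) has norm exactly (m+1)‖A‖|z|^m, in all directions alike, and the
error is at most half of ‖A‖|z|^m. In particular the critical point at 0 is isolated, if it is one.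
-/
lemma HasHarmonicLeadingTerm.norm_fderiv_bounds {g : ℂ → ℝ} {m : ℕ} {A : ℂ}
    (h : HasHarmonicLeadingTerm g m A) :
    ∀ᶠ z in 𝓝[≠] (0 : ℂ), ‖A‖ / 2 * ‖z‖ ^ m ≤ ‖fderiv ℝ g z‖ ∧
      ‖fderiv ℝ g z‖ ≤ ((m + 2) * ‖A‖) * ‖z‖ ^ m := by
  obtain ⟨r₀, hr₀, -, hest⟩ := h.exists_estimates univ_mem
  have hA := norm_pos_iff.2 h.ne_zero
  filter_upwards [self_mem_nhdsWithin, nhdsWithin_le_nhds (Metric.closedBall_mem_nhds 0 hr₀)]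
    with z hz hzr
  obtain ⟨-, -, hv⟩ := hest z hzr
  have hzp := norm_pos_iff.2 hz
  set P : ℂ := (m + 1) * A * z ^ m with hP
  have hPn : ‖P‖ = (m + 1) * ‖A‖ * ‖z‖ ^ m := by
    rw [hP, norm_mul, norm_mul, norm_pow]
    congr 2
    exact_mod_cast Complex.norm_natCast (m + 1)
  have hzm : 0 < ‖z‖ ^ m := by positivity
  have hPpos : 0 < ‖P‖ := by rw [hPn]; positivity
  have hPge : ‖A‖ * ‖z‖ ^ m ≤ ‖P‖ := by
    rw [hPn]
    have : (0 : ℝ) ≤ m := by positivity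
    have : 0 ≤ m * (‖A‖ * ‖z‖ ^ m) := by positivity
    linarith
  constructor
  -- The conjugate of P is the direction of steepest ascent: there Re(P v) = ‖P‖‖v‖.
  · have hc0 : starRingEnd ℂ P ≠ 0 := by
      rw [← norm_pos_iff, RCLike.norm_conj]; exact hPpos
    have h1 := hv _ hz hc0
    rw [Complex.mul_conj, Complex.ofReal_re, Complex.normSq_eq_norm_sq, RCLike.norm_conj] at h1
    have h2 := (abs_lt.1 h1).1
    have h3 := (le_abs_self _).trans ((fderiv ℝ g z).le_opNorm (starRingEnd ℂ P))
    rw [RCLike.norm_conj] at h3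
    refine le_of_mul_le_mul_right ?_ hPpos
    nlinarith
  · refine ContinuousLinearMap.opNorm_le_bound _ (by positivity) fun v => ?_
    by_cases hv0 : v = 0
    · simp [hv0]
    have h1 := hv v hz hv0
    have h2 : |(P * v).re| ≤ ‖P‖ * ‖v‖ := (Complex.abs_re_le_norm _).trans (norm_mul _ _).le
    have h3 := abs_sub_abs_le_abs_sub (fderiv ℝ g z v) (P * v).re
    rw [Real.norm_eq_abs]
    have h4 : 0 ≤ ‖A‖ * ‖z‖ ^ m * ‖v‖ := by positivity
    rw [hPn] at h2
    nlinarith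

lemma HasHarmonicLeadingTerm.isVertexOfDegree {f : Plane → ℝ} {p : Plane} {m : ℕ} {A : ℂ}
    (h : HasHarmonicLeadingTerm (fun z => f (p + toPlane z)) m A) (hU : U ∈ 𝓝 p) :
    IsVertexOfDegree (nodalSet U f) p (2 * (m + 1)) := by
  have hcont : Continuous fun z : ℂ => p + toPlane z := continuous_const.add toPlane.continuous
  have hS : (fun z : ℂ => p + toPlane z) ⁻¹' U ∈ 𝓝 (0 : ℂ) :=
    hcont.continuousAt.preimage_mem_nhds (by simpa using hU)
  have hinj : Function.Injective fun z : ℂ => p + toPlane z := fun a b hab =>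
    toPlane.injective (add_left_cancel hab)
  obtain ⟨V, hV, hVS, e, he1, he2, he3, he4, he5⟩ := h.exists_arcs hS
  have him : ∀ i, (fun s => p + toPlane (e i s)) '' Icc 0 1 =
      (fun z : ℂ => p + toPlane z) '' (e i '' Icc 0 1) := fun i => by rw [image_image]
  have hV' : (fun x => toPlane.symm (x - p)) ⁻¹' V ∈ 𝓝 p := by
    have : Continuous fun x => toPlane.symm (x - p) :=
      toPlane.symm.continuous.comp (continuous_id.sub continuous_const)
    exact this.continuousAt.preimage_mem_nhds (by simpa using hV)
  refine ⟨_, hV', fun i s => p + toPlane (e i s), fun i => hcont.comp_continuousOn (he1 i),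
    fun i => hinj.injOn.comp (he2 i) (mapsTo_univ _ _), fun i => by simp [he3], fun i j hij => ?_, ?_⟩
  · rw [him, him, ← image_inter hinj, he4 i j hij]; simp
  · simp only [him, ← image_iUnion]
    have h0 : ({p} : Set Plane) = (fun z : ℂ => p + toPlane z) '' {0} := by simp
    rw [h0, ← image_union, ← he5]
    ext x
    constructor
    · rintro ⟨⟨-, hx⟩, hxV⟩
      refine ⟨toPlane.symm (x - p), ⟨?_, hxV⟩, ?_⟩
      · change f (p + toPlane (toPlane.symm (x - p))) = 0
        simpa using hx
      · simp
    · rintro ⟨z, ⟨hz, hzV⟩, rfl⟩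
      refine ⟨⟨hVS hzV, hz⟩, ?_⟩
      simpa using hzV

/-- The hinge of the proof: the same m governs the growth of the gradient and the degree of the
vertex. -/
lemma HasCylExpansionAt.trichotomy {f : Plane → ℝ} {p : Plane} (h : HasCylExpansionAt μ f p) :
    (∀ᶠ x in 𝓝 p, f x = 0) ∨ f p ≠ 0 ∨ ∃ (m : ℕ) (c C : ℝ), 0 < c ∧
      (∀ᶠ x in 𝓝[≠] p, c * ‖x - p‖ ^ m ≤ ‖fderiv ℝ f x‖ ∧ ‖fderiv ℝ f x‖ ≤ C * ‖x - p‖ ^ m) ∧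
      ∀ U ∈ 𝓝 p, IsVertexOfDegree (nodalSet U f) p (2 * (m + 1)) := by
  have hcont : Continuous fun x => toPlane.symm (x - p) :=
    toPlane.symm.continuous.comp (continuous_id.sub continuous_const)
  have htend : Tendsto (fun x => toPlane.symm (x - p)) (𝓝 p) (𝓝 0) := by
    simpa using hcont.tendsto p
  rcases HasCylExpansion.trichotomy h with h0 | h0 | ⟨m, A, hA⟩
  · left
    filter_upwards [htend.eventually h0] with x hx
    simpa using hx
  · right; left; simpa using h0
  · right; right
    refine ⟨m, ‖A‖ / 2, (m + 2) * ‖A‖, by have := norm_pos_iff.2 hA.ne_zero; positivity, ?_,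
      fun U hU => hA.isVertexOfDegree hU⟩
    have htend' : Tendsto (fun x => toPlane.symm (x - p)) (𝓝[≠] p) (𝓝[≠] 0) :=
      tendsto_nhdsWithin_iff.2 ⟨htend.mono_left nhdsWithin_le_nhds, by
        filter_upwards [self_mem_nhdsWithin] with x hx
        simpa [sub_eq_zero] using hx⟩
    filter_upwards [htend'.eventually hA.norm_fderiv_bounds] with x hx
    rw [norm_fderiv_comp_toPlane, LinearIsometryEquiv.apply_symm_apply, add_sub_cancel,
      toPlane.symm.norm_map] at hx
    exact hx

/-- Unique continuation for solutions of `Δ w = 4 μ w`. -/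
lemma not_eventually_eq_zero (hUo : IsOpen U) (hUc : IsPreconnected U) (hw : ContDiffOn ℝ 2 w U)
    (hΔ : ∀ z ∈ U, (Δ w) z = 4 * μ * w z) (hw0 : ∃ z ∈ U, w z ≠ 0) {p : Plane} (hp : p ∈ U) :
    ¬ ∀ᶠ x in 𝓝 p, w x = 0 := by
  intro hev
  obtain ⟨z, hzU, hz⟩ := hw0
  set S : Set Plane := {p | ∀ᶠ x in 𝓝 p, w x = 0} with hS
  have hSo : IsOpen S := isOpen_iff_mem_nhds.2 fun x hx => eventually_eventually_nhds.2 hx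
  have hzero : ∀ x ∈ S, w x = 0 ∧ fderiv ℝ w x = 0 := fun x hx => by
    have h : w =ᶠ[𝓝 x] fun _ => 0 := hx
    refine ⟨h.self_of_nhds, ?_⟩
    rw [h.fderiv_eq]
    simp
  suffices hUS : U ⊆ S from hz (hzero z (hUS hzU)).1
  -- Connectedness: S is open, and a limit point of S in U falls under the first alternative. The
  -- others make `w`, or its derivative, nonzero at all nearby points other than the limit point.
  refine hUc.subset_of_closure_inter_subset hSo ⟨p, hp, hev⟩ ?_
  rintro x ⟨hxS, hxU⟩
  rcases (hasCylExpansionAt_of_laplacian hUo hw hΔ hxU).trichotomy with h | h | ⟨m, c, C, hc, h, -⟩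
  · exact h
  · have hne := (hw.continuousOn.continuousAt (hUo.mem_nhds hxU)).eventually_ne h
    obtain ⟨y, hy, hyS⟩ := (mem_closure_iff_frequently.1 hxS).and_eventually hne |>.exists
    exact absurd (hzero y hy).1 hyS
  · by_contra hxS'
    have hfr : ∃ᶠ y in 𝓝[≠] x, y ∈ S := by
      rw [frequently_nhdsWithin_iff]
      refine (mem_closure_iff_frequently.1 hxS).mono fun y hy => ⟨hy, ?_⟩
      rintro rfl
      exact hxS' hy
    obtain ⟨y, ⟨hyS, hy⟩, hyx⟩ := ((hfr.and_eventually h).and_eventually self_mem_nhdsWithin).exists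
    have hpos : 0 < ‖y - x‖ := norm_pos_iff.2 (sub_ne_zero.2 hyx)
    have := hy.1
    rw [(hzero y hyS).2, norm_zero] at this
    have h2 : 0 < c * ‖y - x‖ ^ m := by positivity
    linarith

end Eigenfunction

/-! ### Normal lines and centres of curvature -/

lemma norm_sq_plane (v : Plane) : ‖v‖ ^ 2 = v 0 ^ 2 + v 1 ^ 2 := by
  rw [EuclideanSpace.norm_sq_eq, Fin.sum_univ_two]; simp

lemma inner_plane (u v : Plane) : inner ℝ u v = u 0 * v 0 + u 1 * v 1 := by
  rw [PiLp.inner_apply, Fin.sum_univ_two]; simp [mul_comm]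

lemma quarterTurn_zero_apply (v : Plane) : quarterTurn v 0 = -v 1 := by simp [quarterTurn]

lemma quarterTurn_one_apply (v : Plane) : quarterTurn v 1 = v 0 := by simp [quarterTurn]

lemma norm_quarterTurn (v : Plane) : ‖quarterTurn v‖ = ‖v‖ := by
  rw [← sq_eq_sq₀ (norm_nonneg _) (norm_nonneg _), norm_sq_plane, norm_sq_plane,
    quarterTurn_zero_apply, quarterTurn_one_apply]
  ring

/-- `quarterTurn` as a continuous linear map. -/
noncomputable def quarterTurnCLM : Plane →L[ℝ] Plane :=
  LinearMap.toContinuousLinearMap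
    { toFun := quarterTurn
      map_add' := fun u v => by
        ext i; fin_cases i <;> simp [quarterTurn]; ring
      map_smul' := fun c v => by
        ext i; fin_cases i <;> simp [quarterTurn] }

lemma quarterTurnCLM_apply (v : Plane) : quarterTurnCLM v = quarterTurn v := rfl

lemma plane_eq (v : Plane) : v = v 0 • toPlane 1 + v 1 • toPlane Complex.I := by
  ext i
  fin_cases i <;> simp [toPlane_apply_zero, toPlane_apply_one]

/-- The function whose zeros are the parameters where the normal line passes through `q`. -/
noncomputable def normalDefect (γ : ℝ → Plane) (q : Plane) (s : ℝ) : ℝ :=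
  inner ℝ (deriv γ s) (γ s - q)

lemma mem_normalLine_iff {γ : ℝ → Plane} {q : Plane} {t : ℝ} :
    q ∈ normalLine γ t ↔ normalDefect γ q t = 0 := by
  rw [normalLine, mem_ofPred_eq, normalDefect, ← neg_sub q, inner_neg_right, neg_eq_zero]

/-- The right-hand side says that `normalDefect` and its derivative vanish. This is a linear system
for γ t − q with determinant κ|γ'|³ up to sign; for κ = 0 it has no solution, since |γ'|² ≠ 0. -/
lemma isCentreOfCurvature_iff {γ : ℝ → Plane} {q : Plane} {t : ℝ} (hreg : deriv γ t ≠ 0) :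
    IsCentreOfCurvature γ t q ↔ normalDefect γ q t = 0 ∧
      inner ℝ (deriv (deriv γ) t) (γ t - q) + ‖deriv γ t‖ ^ 2 = 0 := by
  have hr := norm_pos_iff.2 hreg
  have hr2 := norm_sq_plane (deriv γ t)
  rw [normalDefect, inner_plane, inner_plane]
  have hκ : signedCurvature γ t * ‖deriv γ t‖ ^ 3 =
      deriv γ t 0 * deriv (deriv γ) t 1 - deriv γ t 1 * deriv (deriv γ) t 0 := by
    rw [signedCurvature]; field_simp
  have hq : q = γ t + (signedCurvature γ t)⁻¹ • unitNormal γ t ↔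
      (γ t - q) 0 = (signedCurvature γ t)⁻¹ * ‖deriv γ t‖⁻¹ * deriv γ t 1 ∧
      (γ t - q) 1 = -((signedCurvature γ t)⁻¹ * ‖deriv γ t‖⁻¹ * deriv γ t 0) := by
    constructor
    · intro h
      have h' : γ t - q = -((signedCurvature γ t)⁻¹ • unitNormal γ t) := by rw [h]; abel
      rw [h']
      constructor <;> simp [unitNormal, quarterTurn, mul_assoc]
    · rintro ⟨h0, h1⟩
      ext i
      fin_cases i
      · simp [unitNormal, quarterTurn] at h0 ⊢; linarith
      · simp [unitNormal, quarterTurn] at h1 ⊢; linarith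
  rw [IsCentreOfCurvature, hq]
  set κ := signedCurvature γ t
  set r := ‖deriv γ t‖
  set a := deriv γ t 0
  set b := deriv γ t 1
  set x := deriv (deriv γ) t 0
  set y := deriv (deriv γ) t 1
  set u := (γ t - q) 0
  set v := (γ t - q) 1
  constructor
  · rintro ⟨hκ0, hu, hv⟩
    rw [hu, hv]
    constructor
    · ring
    · field_simp
      linear_combination hκ
  · rintro ⟨h0, h1⟩
    -- Being orthogonal to (a, b), the vector (u, v) is a multiple of (b, −a); the second equation
    -- then fixes the multiple as 1/(κ r).
    have e1 : u * r ^ 2 = (u * b - v * a) * b := by rw [hr2]; linear_combination a * h0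
    have e2 : v * r ^ 2 = -((u * b - v * a) * a) := by rw [hr2]; linear_combination b * h0
    have e3 : (u * b - v * a) * κ = r := by
      have : r ^ 3 * ((u * b - v * a) * κ) = r ^ 3 * r := by
        linear_combination (u * b - v * a) * hκ - r ^ 2 * h1 + x * e1 + y * e2
      exact mul_left_cancel₀ (by positivity) this
    have hκ0 : κ ≠ 0 := by
      intro h; rw [h, mul_zero] at e3; exact hr.ne e3
    have e4 : u * b - v * a = r / κ := by rw [← e3]; field_simp
    rw [e4] at e1 e2
    refine ⟨hκ0, ?_, ?_⟩
    · have : r ^ 2 * u = r ^ 2 * (κ⁻¹ * r⁻¹ * b) := by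
        field_simp; field_simp at e1; linarith
      exact mul_left_cancel₀ (by positivity) this
    · have : r ^ 2 * v = r ^ 2 * (-(κ⁻¹ * r⁻¹ * a)) := by
        field_simp; field_simp at e2; linarith
      exact mul_left_cancel₀ (by positivity) this

/-! ### Arcs of critical points -/

section Arc

variable {γ : ℝ → Plane} {I : Set ℝ}

lemma IsAnalyticArc.accPt (hγ : IsAnalyticArc γ I) {s : ℝ} (hs : s ∈ I) : AccPt s (𝓟 I) :=
  hγ.ordConnected.isPreconnected.preperfect_of_nontrivial hγ.nontrivial s hs

/-- Limits are taken along I \ {s}, because s may be an endpoint and only parameters in I are known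
to give critical points. -/
lemma IsAnalyticArc.neBot (hγ : IsAnalyticArc γ I) {s : ℝ} (hs : s ∈ I) :
    (𝓝[I \ {s}] s).NeBot := by
  have := accPt_principal_iff_nhdsWithin.1 (hγ.accPt hs)
  exact this

lemma IsAnalyticArc.hasDerivAt (hγ : IsAnalyticArc γ I) {s : ℝ} (hs : s ∈ I) :
    HasDerivAt γ (deriv γ s) s :=
  (hγ.analytic s hs).differentiableAt.hasDerivAt

lemma IsAnalyticArc.hasDerivAt_deriv (hγ : IsAnalyticArc γ I) {s : ℝ} (hs : s ∈ I) :
    HasDerivAt (deriv γ) (deriv (deriv γ) s) s :=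
  (hγ.analytic s hs).deriv.differentiableAt.hasDerivAt

lemma IsAnalyticArc.tendsto_punctured (hγ : IsAnalyticArc γ I) {s : ℝ} (hs : s ∈ I) :
    Tendsto γ (𝓝[I \ {s}] s) (𝓝[≠] (γ s)) := by
  refine tendsto_nhdsWithin_iff.2 ⟨?_, ?_⟩
  · exact (hγ.hasDerivAt hs).continuousAt.tendsto.mono_left nhdsWithin_le_nhds
  · have := (hγ.hasDerivAt hs).eventually_ne (c := γ s) (hγ.regular s hs)
    exact this.filter_mono (nhdsWithin_mono _ fun x hx => hx.2)

lemma IsAnalyticArc.hasDerivAt_normalDefect (hγ : IsAnalyticArc γ I) {s : ℝ} (hs : s ∈ I)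
    (q : Plane) : HasDerivAt (normalDefect γ q)
      (inner ℝ (deriv (deriv γ) s) (γ s - q) + ‖deriv γ s‖ ^ 2) s := by
  have h := (hγ.hasDerivAt_deriv hs).inner ℝ ((hγ.hasDerivAt hs).sub_const q)
  refine h.congr_deriv ?_
  rw [real_inner_self_eq_norm_sq, add_comm]

lemma IsAnalyticArc.analyticOnNhd_normalDefect (hγ : IsAnalyticArc γ I) (q : Plane) :
    AnalyticOnNhd ℝ (normalDefect γ q) I := fun s hs => by
  have h1 := (hγ.analytic s hs).deriv
  have h2 := (hγ.analytic s hs).sub (analyticAt_const (v := q))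
  exact ((innerSL ℝ (E := Plane)).analyticAt_bilinear (deriv γ s, γ s - q)).comp₂ h1 h2

/-- If the normal line passes through `q` along a piece of the arc, the arc lies on a circle. -/
lemma IsAnalyticArc.subset_sphere (hγ : IsAnalyticArc γ I) {q : Plane} {t : ℝ} (ht : t ∈ I)
    (h : ∃ᶠ s in 𝓝[≠] t, normalDefect γ q s = 0) :
    ∃ r : ℝ, 0 < r ∧ γ '' I ⊆ Metric.sphere q r := by
  -- The identity theorem spreads the zeros over all of I; then |γ − q|², whose derivative is twice
  -- `normalDefect`, is constant.
  have hzero := (hγ.analyticOnNhd_normalDefect q).eqOn_zero_of_preconnected_of_frequently_eq_zero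
    hγ.ordConnected.isPreconnected ht h
  have hd : ∀ s ∈ I, HasDerivWithinAt (fun s => ‖γ s - q‖ ^ 2) 0 I s := fun s hs => by
    have h1 := ((hγ.hasDerivAt hs).sub_const q).norm_sq
    have h2 : inner ℝ (γ s - q) (deriv γ s) = 0 := by
      rw [real_inner_comm]; exact hzero hs
    rw [h2, mul_zero] at h1
    exact h1.hasDerivWithinAt
  have hconst : ∀ s ∈ I, ‖γ s - q‖ ^ 2 = ‖γ t - q‖ ^ 2 := fun s hs => by
    have hb := hγ.ordConnected.convex.norm_image_sub_le_of_norm_hasDerivWithin_le (C := 0) hd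
      (fun x _ => by simp) ht hs
    rw [zero_mul] at hb
    exact sub_eq_zero.1 (norm_le_zero_iff.1 hb)
  have hconst' : ∀ s ∈ I, ‖γ s - q‖ = ‖γ t - q‖ := fun s hs =>
    (sq_eq_sq₀ (norm_nonneg _) (norm_nonneg _)).1 (hconst s hs)
  refine ⟨‖γ t - q‖, ?_, ?_⟩
  · rw [norm_pos_iff]
    intro h0
    have := hγ.neBot ht
    obtain ⟨s, hs, hsI⟩ := (((hγ.tendsto_punctured ht).eventually self_mem_nhdsWithin).and
      self_mem_nhdsWithin).exists
    have h1 := hconst' s hsI.1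
    rw [h0, norm_zero, norm_eq_zero] at h1
    exact hs ((sub_eq_zero.1 h1).trans (sub_eq_zero.1 h0).symm)
  · rintro _ ⟨s, hs, rfl⟩
    rw [mem_sphere_iff_norm]
    exact hconst' s hs

variable {U : Set Plane} {w : Plane → ℝ} {μ : ℝ}

/-- At a zero of w the gradient would be nonzero throughout a punctured neighbourhood, yet critical
points accumulate there along the arc. -/
lemma IsAnalyticArc.apply_ne_zero (hγ : IsAnalyticArc γ I) (hUo : IsOpen U)
    (hUc : IsPreconnected U) (hw : ContDiffOn ℝ 2 w U) (hΔ : ∀ z ∈ U, (Δ w) z = 4 * μ * w z)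
    (hw0 : ∃ z ∈ U, w z ≠ 0) (hcrit : γ '' I ⊆ critSet U w) {s : ℝ} (hs : s ∈ I) :
    w (γ s) ≠ 0 := by
  have hmem : ∀ x ∈ I, γ x ∈ critSet U w := fun x hx => hcrit ⟨x, hx, rfl⟩
  have hU := (hmem s hs).1
  rcases (hasCylExpansionAt_of_laplacian hUo hw hΔ hU).trichotomy with h | h | ⟨m, c, C, hc, h, -⟩
  · exact absurd h (not_eventually_eq_zero hUo hUc hw hΔ hw0 hU)
  · exact h
  · exfalso
    have := hγ.neBot hs
    obtain ⟨x, ⟨⟨hx1, -⟩, hx2⟩, hx3⟩ := ((((hγ.tendsto_punctured hs).eventually h).and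
      ((hγ.tendsto_punctured hs).eventually self_mem_nhdsWithin)).and self_mem_nhdsWithin).exists
    rw [(hmem x hx3.1).2, norm_zero] at hx1
    have hpos : 0 < ‖γ x - γ s‖ := norm_pos_iff.2 (sub_ne_zero.2 hx2)
    have : 0 < c * ‖γ x - γ s‖ ^ m := by positivity
    linarith

/-- Since ∇w = 0 on the arc, only the Hessian contributes to ∇(R_q w). It is symmetric, kills the
tangent T and has trace 4μw, so it has rank at most one along the normal. Pairing the normal with
the quarter turn of γ − q gives ⟨T, γ − q⟩/|T|. -/
lemma IsAnalyticArc.norm_fderiv_rotDeriv (hγ : IsAnalyticArc γ I) (hUo : IsOpen U)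
    (hw : ContDiffOn ℝ 2 w U) (hΔ : ∀ z ∈ U, (Δ w) z = 4 * μ * w z)
    (hcrit : γ '' I ⊆ critSet U w) (q : Plane) {s : ℝ} (hs : s ∈ I) :
    ‖fderiv ℝ (rotDeriv q w) (γ s)‖ =
      |4 * μ * w (γ s)| / ‖deriv γ s‖ * |normalDefect γ q s| := by
  have hmem : ∀ x ∈ I, γ x ∈ critSet U w := fun x hx => hcrit ⟨x, hx, rfl⟩
  have hU := (hmem s hs).1
  have hwat : ContDiffAt ℝ 2 w (γ s) := hw.contDiffAt (hUo.mem_nhds hU)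
  have hd : DifferentiableAt ℝ (fderiv ℝ w) (γ s) :=
    (hwat.fderiv_right (m := 1) (by norm_num)).differentiableAt (by norm_num)
  set B := fderiv ℝ (fderiv ℝ w) (γ s) with hB
  set T := deriv γ s with hT
  have hTpos : 0 < ‖T‖ := norm_pos_iff.2 (hγ.regular s hs)
  -- Differentiate ∇w ∘ γ = 0. The derivative is taken within I, outside which γ may leave the
  -- critical set.
  have hBT : B T = 0 := by
    have h1 := (hd.hasFDerivAt.comp_hasDerivAt s (hγ.hasDerivAt hs)).hasDerivWithinAt (s := I)
    have h2 : HasDerivWithinAt (fderiv ℝ w ∘ γ) 0 I s :=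
      (hasDerivWithinAt_const s I (0 : Plane →L[ℝ] ℝ)).congr (fun x hx => (hmem x hx).2)
        (hmem s hs).2
    exact (uniqueDiffWithinAt_iff_accPt.2 (hγ.accPt hs)).eq_deriv _ h1 h2
  have hsymm : ∀ u v, B u v = B v u := fun u v =>
    (hwat.isSymmSndFDerivAt (by simp)) u v
  have htr := hΔ _ hU
  rw [laplacian_eq_toPlane, ← hB] at htr
  have hfd : fderiv ℝ (rotDeriv q w) (γ s) =
      (4 * μ * w (γ s) * normalDefect γ q s / ‖T‖ ^ 2) • innerSL ℝ (quarterTurn T) := by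
    have h1 : HasFDerivAt (fun z => quarterTurnCLM (z - q)) quarterTurnCLM (γ s) :=
      quarterTurnCLM.hasFDerivAt.comp (γ s) ((hasFDerivAt_id _).sub_const q)
    have h2 := (hd.hasFDerivAt.clm_apply h1).fderiv
    change fderiv ℝ (rotDeriv q w) (γ s) = _ at h2
    rw [h2, (hmem s hs).2]
    ext v
    have e0 := DFunLike.congr_fun hBT (toPlane 1)
    have e1 := DFunLike.congr_fun hBT (toPlane Complex.I)
    have es := hsymm (toPlane 1) (toPlane Complex.I)
    rw [plane_eq T] at e0 e1
    have hQ := plane_eq (quarterTurn (γ s - q))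
    rw [quarterTurn_zero_apply, quarterTurn_one_apply] at hQ
    have hlhs : B v (quarterTurn (γ s - q)) =
        v 0 * (-(γ s - q) 1 * B (toPlane 1) (toPlane 1) +
          (γ s - q) 0 * B (toPlane 1) (toPlane Complex.I)) +
        v 1 * (-(γ s - q) 1 * B (toPlane Complex.I) (toPlane 1) +
          (γ s - q) 0 * B (toPlane Complex.I) (toPlane Complex.I)) := by
      conv_lhs => rw [hQ, plane_eq v]
      simp only [map_add, map_smul, add_apply, smul_apply, smul_eq_mul]
      ring
    have hr2 := norm_sq_plane T
    simp only [map_add, map_smul, add_apply, smul_apply, smul_eq_mul, zero_apply] at e0 e1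
    rw [smul_apply, innerSL_apply_apply, inner_plane, quarterTurn_zero_apply,
      quarterTurn_one_apply, normalDefect, inner_plane, ← hT, smul_eq_mul]
    have hmain : ‖T‖ ^ 2 * B v (quarterTurn (γ s - q)) = 4 * μ * w (γ s) *
        (T 0 * (γ s - q) 0 + T 1 * (γ s - q) 1) * (-T 1 * v 0 + T 0 * v 1) := by
      rw [hlhs, hr2, ← htr]
      generalize (γ s - q) 0 = x at *
      generalize (γ s - q) 1 = y at *
      generalize T 0 = a at *
      generalize T 1 = b at *
      generalize v 0 = c at *
      generalize v 1 = d at *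
      generalize B (toPlane 1) (toPlane 1) = p at *
      generalize B (toPlane 1) (toPlane Complex.I) = m at *
      generalize B (toPlane Complex.I) (toPlane 1) = m' at *
      generalize B (toPlane Complex.I) (toPlane Complex.I) = n at *
      subst es
      linear_combination (c * x - d * y) * (a * e1 + b * e0) + (c * y + d * x) * (b * e1 - a * e0)
    simp only [ContinuousLinearMap.zero_comp, zero_add, ContinuousLinearMap.flip_apply,
      quarterTurnCLM_apply, ← hB]
    rw [div_mul_eq_mul_div, eq_div_iff (by positivity)]
    linear_combination hmain
  rw [hfd, norm_smul, innerSL_apply_norm, norm_quarterTurn, Real.norm_eq_abs, abs_div, abs_mul,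
    abs_of_pos (by positivity : 0 < ‖T‖ ^ 2)]
  field_simp

end Arc

/-! ### Order of vanishing and degree of the vertex -/

lemma HasDerivAt.tendsto_norm_slope {E : Type*} [NormedAddCommGroup E] [NormedSpace ℝ E]
    {f : ℝ → E} {f' : E} {t : ℝ} (h : HasDerivAt f f' t) (I : Set ℝ) :
    Tendsto (fun s => ‖f s - f t‖ / |s - t|) (𝓝[I \ {t}] t) (𝓝 ‖f'‖) := by
  have h1 := (hasDerivAt_iff_tendsto_slope.1 h).norm.mono_left
    (nhdsWithin_mono t (show I \ {t} ⊆ {t}ᶜ from fun x hx => hx.2))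
  refine h1.congr fun s => ?_
  rw [slope_def_module, norm_smul, norm_inv, Real.norm_eq_abs, inv_mul_eq_div]

/-- The degree of the vertex `γ t` of the nodal set of the rotational derivative, in terms of the
order of vanishing of `normalDefect γ q` at `t`. -/
theorem IsAnalyticArc.exists_isVertexOfDegree {U : Set Plane} {w : Plane → ℝ} {μ : ℝ}
    {γ : ℝ → Plane} {I : Set ℝ} (hγ : IsAnalyticArc γ I) (hUo : IsOpen U)
    (hUc : IsPreconnected U) (hμ : μ ≠ 0) (hw : ContDiffOn ℝ 2 w U)
    (hΔ : ∀ z ∈ U, (Δ w) z = 4 * μ * w z) (hw0 : ∃ z ∈ U, w z ≠ 0)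
    (hcrit : γ '' I ⊆ critSet U w)
    (hcirc : ¬ ∃ c : Plane, ∃ r : ℝ, 0 < r ∧ γ '' I ⊆ Metric.sphere c r)
    {t : ℝ} (ht : t ∈ I) (q : Plane) :
    ∃ m : ℕ, IsVertexOfDegree (nodalSet U (rotDeriv q w)) (γ t) (2 * (m + 1)) ∧
      (m = 0 ↔ normalDefect γ q t ≠ 0) ∧
      (m = 1 ↔ normalDefect γ q t = 0 ∧
        inner ℝ (deriv (deriv γ) t) (γ t - q) + ‖deriv γ t‖ ^ 2 ≠ 0) := by
  have hmem : ∀ x ∈ I, γ x ∈ critSet U w := fun x hx => hcrit ⟨x, hx, rfl⟩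
  have hU := (hmem t ht).1
  set f := rotDeriv q w with hf
  have hnorm := fun s (hs : s ∈ I) => hγ.norm_fderiv_rotDeriv hUo hw hΔ hcrit q hs
  have hcoef : ∀ s ∈ I, 0 < |4 * μ * w (γ s)| / ‖deriv γ s‖ := fun s hs =>
    div_pos (abs_pos.2 (mul_ne_zero (mul_ne_zero four_ne_zero hμ)
      (hγ.apply_ne_zero hUo hUc hw hΔ hw0 hcrit hs))) (norm_pos_iff.2 (hγ.regular s hs))
  have hneBot := hγ.neBot ht
  have hI : ∀ᶠ s in 𝓝[I \ {t}] t, s ∈ I \ {t} := self_mem_nhdsWithin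
  have hγc : ContinuousAt γ t := (hγ.hasDerivAt ht).continuousAt
  rcases ((hasCylExpansionAt_of_laplacian hUo hw hΔ hU).rotDeriv q).trichotomy with
    h | h | ⟨m, c, C, hc, hbd, hvert⟩
  · exfalso
    refine hcirc ⟨q, hγ.subset_sphere ht ?_⟩
    have h0 : ∀ᶠ s in 𝓝[I \ {t}] t, normalDefect γ q s = 0 := by
      have h1 : ∀ᶠ x in 𝓝 (γ t), fderiv ℝ f x = 0 := by
        filter_upwards [eventually_eventually_nhds.2 h] with x hx
        have : f =ᶠ[𝓝 x] fun _ => 0 := hx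
        rw [this.fderiv_eq]; simp
      filter_upwards [(hγc.tendsto.eventually h1).filter_mono nhdsWithin_le_nhds, hI] with s hs hsI
      have := hnorm s hsI.1
      rw [hs, norm_zero] at this
      exact abs_eq_zero.1 ((mul_eq_zero.1 this.symm).resolve_left (hcoef s hsI.1).ne')
    exact h0.frequently.filter_mono (nhdsWithin_mono t fun x hx => hx.2)
  · exact absurd (by rw [rotDeriv, (hmem t ht).2]; simp) h
  refine ⟨m, hvert U (hUo.mem_nhds hU), ?_⟩
  set l := 𝓝[I \ {t}] t with hl
  set F : ℝ → ℝ := fun s => ‖fderiv ℝ f (γ s)‖ with hF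
  set k : ℝ → ℝ := fun s => |4 * μ * w (γ s)| / ‖deriv γ s‖ with hk
  have hk0 : 0 < k t := hcoef t ht
  have hkt : Tendsto k l (𝓝 (k t)) := by
    have h1 : ContinuousAt (fun s => w (γ s)) t :=
      (hw.continuousOn.continuousAt (hUo.mem_nhds hU)).comp hγc
    have h2 : ContinuousAt (deriv γ) t := (hγ.hasDerivAt_deriv ht).continuousAt
    exact (ContinuousAt.div (continuousAt_const.mul h1).abs h2.norm
      (norm_ne_zero_iff.2 (hγ.regular t ht))).tendsto.mono_left nhdsWithin_le_nhds
  have hFk : ∀ᶠ s in l, k s * |normalDefect γ q s| = F s := by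
    filter_upwards [hI] with s hs using (hnorm s hs.1).symm
  have hder := hγ.hasDerivAt_normalDefect ht q
  set g' := inner ℝ (deriv (deriv γ) t) (γ t - q) + ‖deriv γ t‖ ^ 2 with hg'
  -- The limits of F and of F/|s − t| are computed from the arc, then compared with the two-sided
  -- bound by ‖γ s − γ t‖^m, where ‖γ s − γ t‖ ~ |γ'(t)| |s − t|.
  have hF0 : Tendsto F l (𝓝 (k t * |normalDefect γ q t|)) :=
    (hkt.mul (hder.continuousAt.tendsto.abs.mono_left nhdsWithin_le_nhds)).congr' hFk
  have hF1 : normalDefect γ q t = 0 → Tendsto (fun s => F s / |s - t|) l (𝓝 (k t * |g'|)) := by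
    intro h0
    refine (hkt.mul (hder.tendsto_norm_slope I)).congr' ?_
    filter_upwards [hFk] with s hs
    rw [← hs, h0, sub_zero, Real.norm_eq_abs, mul_div_assoc]
  have hdist : Tendsto (fun s => ‖γ s - γ t‖) l (𝓝 0) := by
    have : Tendsto (fun s => ‖γ s - γ t‖) (𝓝 t) (𝓝 ‖γ t - γ t‖) :=
      (hγc.sub continuousAt_const).norm
    rw [sub_self, norm_zero] at this
    exact this.mono_left nhdsWithin_le_nhds
  have hslope := (hγ.hasDerivAt ht).tendsto_norm_slope I
  have hT : 0 < ‖deriv γ t‖ := norm_pos_iff.2 (hγ.regular t ht)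
  have hlow : ∀ᶠ s in l, c * ‖γ s - γ t‖ ^ m ≤ F s :=
    ((hγ.tendsto_punctured ht).eventually hbd).mono fun s hs => hs.1
  have hup : ∀ᶠ s in l, F s ≤ C * ‖γ s - γ t‖ ^ m :=
    ((hγ.tendsto_punctured ht).eventually hbd).mono fun s hs => hs.2
  have hm0 : m = 0 ↔ normalDefect γ q t ≠ 0 := by
    constructor
    · rintro rfl h0
      rw [h0, abs_zero, mul_zero] at hF0
      have := le_of_tendsto_of_tendsto tendsto_const_nhds hF0 (hlow.mono fun s hs => by
        simpa using hs)
      linarith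
    · intro h0
      by_contra hm
      have h1 := (hdist.pow m).const_mul C
      rw [zero_pow hm, mul_zero] at h1
      have := le_of_tendsto_of_tendsto hF0 h1 hup
      have := mul_pos hk0 (abs_pos.2 h0)
      linarith
  refine ⟨hm0, ?_⟩
  constructor
  · rintro rfl
    have h0 : normalDefect γ q t = 0 := by
      by_contra h0
      exact one_ne_zero (hm0.2 h0)
    refine ⟨h0, fun h1 => ?_⟩
    have h2 := hF1 h0
    rw [h1, abs_zero, mul_zero] at h2
    have := le_of_tendsto_of_tendsto (hslope.const_mul c) h2 (by
      filter_upwards [hlow] with s hs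
      rw [pow_one] at hs
      rw [← mul_div_assoc]
      gcongr)
    have := mul_pos hc hT
    linarith
  · rintro ⟨h0, h1⟩
    have hm : m ≠ 0 := fun hm => hm0.1 hm h0
    by_contra hm1
    -- For m ≥ 2 the upper bound would force F/|s − t| → 0, against the nonzero limit k(t)|δ'(t)|.
    obtain ⟨n, rfl⟩ : ∃ n, m = n + 2 := ⟨m - 2, by omega⟩
    have h2 := ((hdist.pow (n + 1)).const_mul C).mul hslope
    rw [zero_pow (by omega), mul_zero, zero_mul] at h2
    have := le_of_tendsto_of_tendsto (hF1 h0) h2 (by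
      filter_upwards [hup] with s hs
      rw [← mul_div_assoc, mul_assoc, ← pow_succ]
      gcongr)
    have := mul_pos hk0 (abs_pos.2 h1)
    linarith

end

theorem mainTheorem3 (U : Set Plane) (hUo : IsOpen U) (hUc : IsConnected U)
    (lam : ℝ) (hlam : lam ≠ 0)
    (w : Plane → ℝ) (hw : ContDiffOn ℝ 2 w U)
    (hΔ : ∀ z ∈ U, (Δ w) z = lam * w z)
    (hw0 : ∃ z ∈ U, w z ≠ 0)
    (γ : ℝ → Plane) (I : Set ℝ) (hγ : IsAnalyticArc γ I)
    (hcirc : ¬ ∃ c : Plane, ∃ r : ℝ, 0 < r ∧ γ '' I ⊆ Metric.sphere c r)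
    (hline : ¬ Collinear ℝ (γ '' I))
    (hcrit : γ '' I ⊆ critSet U w)
    (t : ℝ) (ht : t ∈ I) (q : Plane) :
    (q ∉ normalLine γ t →
      IsVertexOfDegree (nodalSet U (rotDeriv q w)) (γ t) 2) ∧
    (q ∈ normalLine γ t → ¬ IsCentreOfCurvature γ t q →
      IsVertexOfDegree (nodalSet U (rotDeriv q w)) (γ t) 4) ∧
    (IsCentreOfCurvature γ t q →
      ∃ d : ℕ, 6 ≤ d ∧ IsVertexOfDegree (nodalSet U (rotDeriv q w)) (γ t) d) := by
  -- The Laplacian is 4 ∂²/∂z∂z̄, so the ladder with factor μ fits the eigenvalue 4μ.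
  have hΔ' : ∀ z ∈ U, (Δ w) z = 4 * (lam / 4) * w z := fun z hz => by
    rw [hΔ z hz]; ring
  obtain ⟨m, hvert, hm0, hm1⟩ := hγ.exists_isVertexOfDegree hUo hUc.isPreconnected
    (div_ne_zero hlam four_ne_zero) hw hΔ' hw0 hcrit hcirc ht q
  have hcentre := isCentreOfCurvature_iff (q := q) (hγ.regular t ht)
  rw [mem_normalLine_iff]
  refine ⟨fun h => ?_, fun h hc => ?_, fun hc => ?_⟩
  · obtain rfl := hm0.2 h
    exact hvert
  · obtain rfl := hm1.2 ⟨h, fun h' => hc (hcentre.2 ⟨h, h'⟩)⟩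
    exact hvert
  · obtain ⟨h, h'⟩ := hcentre.1 hc
    refine ⟨_, ?_, hvert⟩
    have h0 : m ≠ 0 := fun hm => hm0.1 hm h
    have h1 : m ≠ 1 := fun hm => (hm1.1 hm).2 h'
    omega
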